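/- Theorem 2. In ZF, the axiom of choice is equivalent to the maximum principle of forcing. That is, for every model $M$ of ZF, the axiom of choice (every set of nonempty sets has a choice function) holds in $M$ if and only if the following holds in $M$: for every partial order $\mathbb P=(\mathbb P,\unlhd)$, every formula $\theta(x,x_1,\dots,x_n)$ of the language of set theory, all $\mathbb P$-names $\sigma_1,\dots,\sigma_n$ and every $p\in\mathbb P$, $$p\Vdash\exists x\,\theta(x,\sigma_1,\dots,\sigma_n)\quad\text{iff}\quad\text{there is a }\mathbb P\text{-name }\tau\text{ with }p\Vdash\theta(\tau,\sigma_1,\dots,\sigma_n).$$ Here a $\mathbb P$-name is a set of pairs $(s,\pi)$ with $s\in\mathbb P$ and $\pi$ a $\mathbb P$-name, and $\Vdash$ is the usual forcing relation defined in the ground model, in which $p\Vdash\exists x\,\theta(x)$ means that for every $q\unlhd p$ there are $r\unlhd q$ and a $\mathbb P$-name $\tau$ with $r\Vdash\theta(\tau)$. -/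

import Mathlib

open FirstOrder FirstOrder.Language

namespace MaxPrinciple

universe u

/-- The only symbol of the language of set theory: one binary relation symbol. -/
inductive SetRel : ℕ → Type
  | mem : SetRel 2

/-- The first-order language of set theory. Equality is a logical symbol. -/
def LSet : FirstOrder.Language.{0, 0} :=
  ⟨fun _ => Empty, SetRel⟩

section Model

variable {M : Type u} [LSet.Structure M]

/-- The membership relation of an arbitrary structure `M` for the language of set theory. -/
def Mem (x y : M) : Prop :=
  Structure.RelMap (L := LSet) SetRel.mem ![x, y]

infix:50 " ∊ " => MaxPrinciple.Mem

/-- In `M`: `w = {x, y}`. -/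
def IsUPair (w x y : M) : Prop :=
  ∀ u, u ∊ w ↔ u = x ∨ u = y

/-- In `M`: `z` is the (Kuratowski) ordered pair `⟨x, y⟩ = {{x}, {x, y}}`. -/
def IsOPair (z x y : M) : Prop :=
  ∀ w, w ∊ z ↔ IsUPair w x x ∨ IsUPair w x y

/-- In `M`: `⟨x, y⟩ ∈ f`. -/
def PairMem (x y f : M) : Prop :=
  ∃ z, IsOPair z x y ∧ z ∊ f

variable (M) in
/-- `M` is a model of Zermelo-Fraenkel set theory `ZF` (without choice). In the two axiom schemes
the classes range over those defined in `M` by a first-order formula with parameters from `M`. -/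
structure IsModelZF : Prop where
  extensionality : ∀ a b : M, (∀ x, x ∊ a ↔ x ∊ b) → a = b
  foundation : ∀ a : M, (∃ x, x ∊ a) → ∃ x, x ∊ a ∧ ∀ y, y ∊ x → ¬ y ∊ a
  pairing : ∀ a b : M, ∃ c, ∀ x, x ∊ c ↔ x = a ∨ x = b
  union : ∀ a : M, ∃ b, ∀ x, x ∊ b ↔ ∃ y, y ∊ a ∧ x ∊ y
  powerset : ∀ a : M, ∃ b, ∀ x, x ∊ b ↔ ∀ y, y ∊ x → y ∊ a
  infinity : ∃ w : M, (∃ e, e ∊ w ∧ ∀ x, ¬ x ∊ e) ∧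
    ∀ x, x ∊ w → ∃ y, y ∊ w ∧ ∀ z, z ∊ y ↔ z ∊ x ∨ z = x
  separation : ∀ C : Set M, (Set.univ : Set M).Definable₁ LSet C →
    ∀ a : M, ∃ b, ∀ x, x ∊ b ↔ x ∊ a ∧ x ∈ C
  replacement : ∀ F : Set (M × M), (Set.univ : Set M).Definable₂ LSet F →
    ∀ a : M, (∀ x, x ∊ a → ∃! y, (x, y) ∈ F) →
      ∃ b, ∀ y, y ∊ b ↔ ∃ x, x ∊ a ∧ (x, y) ∈ F

variable (M) in
/-- The axiom of choice holds in `M`: every set `a` of nonempty sets has, in `M`, a choice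
function, i.e. a function `f` with domain `a` and `f(x) ∈ x` for all `x ∈ a`. -/
def AxiomOfChoice : Prop :=
  ∀ a : M, (∀ x, x ∊ a → ∃ y, y ∊ x) →
    ∃ f : M, (∀ z, z ∊ f → ∃ x y, IsOPair z x y ∧ x ∊ a ∧ y ∊ x) ∧
      ∀ x, x ∊ a → ∃! y, PairMem x y f

/-- In `M`: `R` is a partial order `⊴` on the set `P`, where `⟨q, p⟩ ∈ R` means `q ⊴ p`. -/
structure IsPartialOrd (P R : M) : Prop where
  subset : ∀ z, z ∊ R → ∃ q p, IsOPair z q p ∧ q ∊ P ∧ p ∊ P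
  refl : ∀ p, p ∊ P → PairMem p p R
  antisymm : ∀ p q, PairMem p q R → PairMem q p R → p = q
  trans : ∀ p q r, PairMem p q R → PairMem q r R → PairMem p r R

/-- In `M`: every element of every member of the set `D` is a pair `⟨s, π⟩` with `s ∈ P` and
`π ∈ D`. -/
def NameClosed (P D : M) : Prop :=
  ∀ a, a ∊ D → ∀ z, z ∊ a → ∃ s π, IsOPair z s π ∧ s ∊ P ∧ π ∊ D

/-- In `M`: `τ` is a `P`-name, i.e. a set of pairs `⟨s, π⟩` with `s ∈ P` and `π` a `P`-name.
By foundation in `M`, this recursion amounts to `τ` belonging to some name-closed set. -/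
def IsName (P τ : M) : Prop :=
  ∃ D, NameClosed P D ∧ τ ∊ D

/-- The clause of the recursive definition of `p ⊩ σ = τ`, where `E r π π'` stands for
`r ⊩ π = π'`. For each `⟨s, π⟩ ∈ σ`, the set of those `r` with `r ⊩ π = π'` for some
`⟨s', π'⟩ ∈ τ` with `r ⊴ s'` meets the conditions below every `q ⊴ p, s`;
and the same with the roles of `σ` and `τ` exchanged. -/
def EqClause (R : M) (E : M → M → M → Prop) (p σ τ : M) : Prop :=
  (∀ s π, PairMem s π σ → ∀ q, PairMem q p R → PairMem q s R →
    ∃ r, PairMem r q R ∧ ∃ s' π', PairMem s' π' τ ∧ PairMem r s' R ∧ E r π π') ∧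
  (∀ s' π', PairMem s' π' τ → ∀ q, PairMem q p R → PairMem q s' R →
    ∃ r, PairMem r q R ∧ ∃ s π, PairMem s π σ ∧ PairMem r s R ∧ E r π π')

/-- In `M`: `⟨p, ⟨σ, τ⟩⟩ ∈ F`. -/
def TripleMem (p σ τ F : M) : Prop :=
  ∃ w, IsOPair w σ τ ∧ PairMem p w F

/-- `p ⊩ σ = τ` for `P`-names `σ, τ`, defined by recursion inside `M`: some set `F` of `M` obeys
the recursive clause on a name-closed set `D` containing `σ` and `τ`, and contains the triple
`⟨p, ⟨σ, τ⟩⟩`. -/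
def ForcesEq (P R p σ τ : M) : Prop :=
  ∃ D F : M, NameClosed P D ∧ σ ∊ D ∧ τ ∊ D ∧
    (∀ q a b, q ∊ P → a ∊ D → b ∊ D →
      (TripleMem q a b F ↔ EqClause R (fun r π π' => TripleMem r π π' F) q a b)) ∧
    TripleMem p σ τ F

/-- `p ⊩ σ ∈ τ` for `P`-names `σ, τ`: the set of those `r` with `r ⊩ σ = π` for some
`⟨s, π⟩ ∈ τ` with `r ⊴ s` is dense below `p`. -/
def ForcesMem (P R p σ τ : M) : Prop :=
  ∀ q, PairMem q p R →
    ∃ r, PairMem r q R ∧ ∃ s π, PairMem s π τ ∧ PairMem r s R ∧ ForcesEq P R r σ π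

/-- Forcing for atomic formulas built from the membership symbol. -/
def ForcesRel (P R p : M) : {l : ℕ} → SetRel l → (Fin l → M) → Prop
  | _, SetRel.mem, v => ForcesMem P R p (v 0) (v 1)

/-- `p ⊩ φ(σ₁, …, σₙ)` for a formula `φ` of set theory and `P`-names `σ₁, …, σₙ`. Formulas are
built from `⊥`, `→`, `∀`. The clause for `φ → ψ` says that there is no `q ⊴ p` with
`q ⊩ φ` and `q ⊩ ¬ ψ`. For the resulting clause for `∃`, see `forces_ex`. -/
def Forces (P R : M) : {n : ℕ} → LSet.BoundedFormula Empty n → (Fin n → M) → M → Prop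
  | _, .falsum, _, _ => False
  | _, .equal s t, v, p =>
      ForcesEq P R p (s.realize (Sum.elim Empty.elim v)) (t.realize (Sum.elim Empty.elim v))
  | _, .rel r ts, v, p =>
      ForcesRel P R p r (fun i => (ts i).realize (Sum.elim Empty.elim v))
  | _, .imp φ ψ, v, p =>
      ∀ q, PairMem q p R → Forces P R φ v q → ∃ r, PairMem r q R ∧ Forces P R ψ v r
  | _, .all φ, v, p => ∀ τ, IsName P τ → Forces P R φ (Fin.snoc v τ) p

/-- `p ⊩ ∃ x θ(x)` iff for all `q ⊴ p` there are `r ⊴ q` and a name `τ` with `r ⊩ θ(τ)`. -/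
theorem forces_ex (P R : M) {n : ℕ} (θ : LSet.BoundedFormula Empty (n + 1)) (v : Fin n → M)
    (p : M) : Forces P R θ.ex v p ↔ ∀ q, PairMem q p R →
      ∃ r, PairMem r q R ∧ ∃ τ, IsName P τ ∧ Forces P R θ (Fin.snoc v τ) r := by
  simp only [Forces, and_false, exists_false, imp_false]
  push Not
  refine forall₂_congr fun q _ => ?_
  constructor
  · rintro ⟨τ, hτ, r, hr, h⟩
    exact ⟨r, hr, τ, hτ, h⟩
  · rintro ⟨r, hr, τ, hτ, h⟩
    exact ⟨τ, hτ, r, hr, h⟩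

variable (M) in
/-- The maximum principle of forcing holds in `M`: for every partial order `(P, R)` of `M`, every
formula `θ(x, x₁, …, xₙ)`, all `P`-names `σ₁, …, σₙ` and every `p ∈ P`:
`p ⊩ ∃ x θ(x, σ₁, …, σₙ)` iff `p ⊩ θ(τ, σ₁, …, σₙ)` for some `P`-name `τ`.
(The variable `x` is the last one of `θ`.) -/
def MaximumPrinciple : Prop :=
  ∀ P R : M, IsPartialOrd P R →
    ∀ (n : ℕ) (θ : LSet.BoundedFormula Empty (n + 1)) (σ : Fin n → M), (∀ i, IsName P (σ i)) →
      ∀ p, p ∊ P →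
        (Forces P R θ.ex σ p ↔ ∃ τ, IsName P τ ∧ Forces P R θ (Fin.snoc σ τ) p)

end Model

end MaxPrinciple

/-! From choice to the maximum principle: suppose `p` forces an existential statement, and let `A`
be the set of conditions that force it of some name. Scott's trick and a choice function pick a
witness `t r` for each `r ∈ A`. Well-order `A` and let `τ` agree with `t r` at conditions below `r`
that are incompatible with every earlier `r' ∈ A` (`exists_mixture`); this "first compatible index"
plays the role of a maximal antichain. Below any `q ⊴ p`, take the least `r ∈ A` compatible with
`q`. A common extension of `q` and `r` forces `τ = t r`, hence `θ(τ)`, and density gives `p ⊩ θ(τ)`.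

From the maximum principle to choice: given a set `a` of nonempty sets, force with the flat order
whose minimal conditions are the elements of `a`, below one top element. Let `σ` be the set of all
`⟨x, y̌⟩` with `y ∈ x ∈ a`. If `a` is nonempty, the top forces `σ` to have an element; a single name
`τ` for one is decided by each atom `x` to be `y̌` for a unique `y ∈ x`, and `x ↦ y` is the choice
function.

Since `M` is an arbitrary model, Separation and Replacement apply only to definable classes.
Definability with parameters is therefore tracked by the classes `DefP` and `DefF`, and the needed
set theory is developed inside `M`: transitive closures, ∈-recursion, a rank hierarchy without
ordinals, and Zermelo's well-ordering theorem. -/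

namespace MaxPrinciple

universe u

/-! ### Classes and functions definable with parameters -/

section Definability

variable {M : Type u} [LSet.Structure M]

/-- `p` is first-order definable in `M` with parameters; the variables are numbered. -/
class DefP (p : (ℕ → M) → Prop) : Prop where
  out : ∃ φ : LSet.Formula (M ⊕ ℕ), ∀ v : ℕ → M, φ.Realize (Sum.elim id v) ↔ p v

/-- The function `f` has a definable graph. -/
class DefF (f : (ℕ → M) → M) : Prop where
  out : DefP fun v : ℕ → M => v 0 = f fun n => v (n + 1)

theorem DefP.congr {p q : (ℕ → M) → Prop} (h : DefP p) (hpq : ∀ v, p v ↔ q v) : DefP q := by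
  have : p = q := funext fun v => propext (hpq v)
  exact this ▸ h

theorem DefP.reindex {p : (ℕ → M) → Prop} (h : DefP p) (e : ℕ → ℕ) :
    DefP fun v => p fun n => v (e n) := by
  obtain ⟨φ, hφ⟩ := h.out
  refine ⟨φ.relabel (Sum.map id e), fun v => ?_⟩
  rw [Formula.realize_relabel, ← hφ]
  have : (Sum.elim id v : M ⊕ ℕ → M) ∘ Sum.map id e = Sum.elim id fun n => v (e n) := by
    funext x
    cases x <;> rfl
  rw [this]

theorem DefF.reindex {f : (ℕ → M) → M} (h : DefF f) (e : ℕ → ℕ) :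
    DefF fun v => f fun n => v (e n) :=
  -- Index 0 carries the value of `f` and stays fixed; the arguments are shifted by one.
  ⟨h.out.reindex fun n => Nat.casesOn n 0 fun k => e k + 1⟩

instance DefP.const (p : Prop) : DefP fun _ : ℕ → M => p := by
  by_cases h : p
  · exact ⟨⊤, fun v => by simp [h, Formula.Realize]⟩
  · exact ⟨⊥, fun v => by simp [h, Formula.Realize]⟩

instance DefP.not {p : (ℕ → M) → Prop} [hp : DefP p] : DefP fun v => ¬ p v := by
  obtain ⟨φ, hφ⟩ := hp.out
  exact ⟨φ.not, fun v => by rw [Formula.realize_not, hφ]⟩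

instance DefP.and {p q : (ℕ → M) → Prop} [hp : DefP p] [hq : DefP q] :
    DefP fun v => p v ∧ q v := by
  obtain ⟨φ, hφ⟩ := hp.out
  obtain ⟨ψ, hψ⟩ := hq.out
  exact ⟨φ ⊓ ψ, fun v => by rw [Formula.realize_inf, hφ, hψ]⟩

instance DefP.or {p q : (ℕ → M) → Prop} [hp : DefP p] [hq : DefP q] :
    DefP fun v => p v ∨ q v := by
  obtain ⟨φ, hφ⟩ := hp.out
  obtain ⟨ψ, hψ⟩ := hq.out
  exact ⟨φ ⊔ ψ, fun v => by rw [Formula.realize_sup, hφ, hψ]⟩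

instance DefP.imp {p q : (ℕ → M) → Prop} [hp : DefP p] [hq : DefP q] :
    DefP fun v => p v → q v := by
  obtain ⟨φ, hφ⟩ := hp.out
  obtain ⟨ψ, hψ⟩ := hq.out
  exact ⟨φ.imp ψ, fun v => by rw [Formula.realize_imp, hφ, hψ]⟩

instance DefP.iff {p q : (ℕ → M) → Prop} [hp : DefP p] [hq : DefP q] :
    DefP fun v => p v ↔ q v := by
  obtain ⟨φ, hφ⟩ := hp.out
  obtain ⟨ψ, hψ⟩ := hq.out
  exact ⟨φ.iff ψ, fun v => by rw [Formula.realize_iff, hφ, hψ]⟩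

/-- Variables are numbered in de Bruijn style: under the quantifier, index 0 is the bound variable
and every other index moves up by one. -/
instance DefP.ex {p : (ℕ → M) → M → Prop} [hp : DefP fun w => p (fun n => w (n + 1)) (w 0)] :
    DefP fun v => ∃ x, p v x := by
  obtain ⟨φ, hφ⟩ := hp.out
  let g : M ⊕ ℕ → (M ⊕ ℕ) ⊕ Fin 1 := Sum.elim (fun a => Sum.inl (Sum.inl a))
    fun n => Nat.casesOn n (Sum.inr 0) fun k => Sum.inl (Sum.inr k)
  refine ⟨(BoundedFormula.relabel (n := 1) (k := 0) g φ).ex, fun v => ?_⟩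
  rw [Formula.Realize, BoundedFormula.realize_ex]
  refine exists_congr fun x => ?_
  rw [BoundedFormula.realize_relabel]
  let w : ℕ → M := fun n => Nat.casesOn n x v
  refine Iff.trans ?_ (hφ w)
  rw [Formula.Realize]
  have h1 : (Sum.elim (Sum.elim id v) (Fin.snoc (default : Fin 0 → M) x ∘ Fin.castAdd 0) ∘ g
      : M ⊕ ℕ → M) = Sum.elim id w := by
    funext y
    rcases y with a | n
    · rfl
    · cases n <;> rfl
  have h2 : (Fin.snoc (default : Fin 0 → M) x ∘ Fin.natAdd 1 : Fin 0 → M) = default :=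
    Subsingleton.elim _ _
  exact iff_of_eq (congrArg₂ (BoundedFormula.Realize φ) h1 h2)

instance DefP.all {p : (ℕ → M) → M → Prop} [hp : DefP fun w => p (fun n => w (n + 1)) (w 0)] :
    DefP fun v => ∀ x, p v x :=
  DefP.congr (p := fun v => ¬ ∃ x, ¬ p v x) inferInstance fun v => by push Not; rfl

instance DefP.exUnique {p : (ℕ → M) → M → Prop}
    [hp : DefP fun w => p (fun n => w (n + 1)) (w 0)] : DefP fun v => ∃! x, p v x := by
  have : DefP fun w : ℕ → M => p (fun n => w (n + 1 + 1)) (w 0) :=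
    hp.reindex fun n => Nat.casesOn n 0 fun k => k + 2
  exact DefP.congr (p := fun v => ∃ x, p v x ∧ ∀ y, p v y → y = x)
    (@DefP.ex _ _ _ (@DefP.and _ _ _ _ hp (@DefP.all _ _ _ (@DefP.imp _ _ _ _ this
      ⟨(Term.var (Sum.inr 0)).equal (Term.var (Sum.inr 1)), fun v => by
        simp [Formula.realize_equal]⟩)))) fun v => Iff.rfl

theorem defP_eq_var (i j : ℕ) : DefP fun v : ℕ → M => v i = v j :=
  ⟨(Term.var (Sum.inr i)).equal (Term.var (Sum.inr j)), fun v => by simp [Formula.realize_equal]⟩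

theorem defP_mem_var (i j : ℕ) : DefP fun v : ℕ → M => v i ∊ v j := by
  let r : LSet.Relations 2 := SetRel.mem
  refine ⟨Relations.formula r ![Term.var (Sum.inr i), Term.var (Sum.inr j)], fun v => ?_⟩
  refine Formula.realize_rel.trans (iff_of_eq (congrArg (Structure.RelMap r) ?_))
  funext k
  fin_cases k <;> rfl

instance DefF.const (a : M) : DefF fun _ : ℕ → M => a :=
  ⟨(Term.var (Sum.inr 0)).equal (Term.var (Sum.inl a)), fun _ => by simp [Formula.realize_equal]⟩

instance DefF.var (i : ℕ) : DefF fun v : ℕ → M => v i :=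
  ⟨defP_eq_var _ _⟩

theorem DefP.subst {q : (ℕ → M) → M → Prop} (h : DefP fun w => q (fun n => w (n + 1)) (w 0))
    {f : (ℕ → M) → M} (hf : DefF f) : DefP fun v => q v (f v) :=
  DefP.congr (@DefP.ex _ _ (fun v x => x = f v ∧ q v x) (@DefP.and _ _ _ _ hf.out h))
    fun _ => exists_eq_left

theorem DefP.subst₁ {C : M → Prop} (h : DefP fun v => C (v 0))
    {f : (ℕ → M) → M} (hf : DefF f) : DefP fun v => C (f v) :=
  DefP.subst (q := fun _ x => C x) h hf

theorem DefP.subst₂ {C : M → M → Prop} (h : DefP fun v => C (v 0) (v 1))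
    {f g : (ℕ → M) → M} (hf : DefF f) (hg : DefF g) : DefP fun v => C (f v) (g v) := by
  refine DefP.subst (q := fun v x => C x (g v)) ?_ hf
  refine DefP.subst (q := fun v y => C (v 0) y) ?_ (hg.reindex _)
  exact h.reindex fun n => Nat.casesOn n 1 fun _ => 0

theorem DefP.subst₃ {C : M → M → M → Prop} (h : DefP fun v => C (v 0) (v 1) (v 2))
    {f g k : (ℕ → M) → M} (hf : DefF f) (hg : DefF g) (hk : DefF k) :
    DefP fun v => C (f v) (g v) (k v) := by
  refine DefP.subst (q := fun v x => C x (g v) (k v)) ?_ hf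
  refine DefP.subst (q := fun v y => C (v 0) y (k fun n => v (n + 1))) ?_ (hg.reindex _)
  refine DefP.subst (q := fun v z => C (v 1) (v 0) z) ?_ (hk.reindex fun n => n + 1 + 1)
  -- The successive substitutions leave the arguments in reverse order, so 0 and 2 are exchanged.
  exact h.reindex fun n => Nat.casesOn n 2 fun m => Nat.casesOn m 1 fun _ => 0

theorem DefP.subst₄ {C : M → M → M → M → Prop} (h : DefP fun v => C (v 0) (v 1) (v 2) (v 3))
    {f g k l : (ℕ → M) → M} (hf : DefF f) (hg : DefF g) (hk : DefF k) (hl : DefF l) :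
    DefP fun v => C (f v) (g v) (k v) (l v) := by
  refine DefP.subst (q := fun v x => C x (g v) (k v) (l v)) ?_ hf
  refine DefP.subst (q := fun v y => C (v 0) y (k fun n => v (n + 1)) (l fun n => v (n + 1))) ?_
    (hg.reindex _)
  refine DefP.subst (q := fun v z => C (v 1) (v 0) z (l fun n => v (n + 2))) ?_
    (hk.reindex fun n => n + 1 + 1)
  refine DefP.subst (q := fun v t => C (v 2) (v 1) (v 0) t) ?_ (hl.reindex fun n => n + 1 + 1 + 1)
  exact h.reindex fun n => Nat.casesOn n 3 fun m => Nat.casesOn m 2 fun k =>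
    Nat.casesOn k 1 fun _ => 0

theorem DefF.subst₁ {G : M → M} (h : DefF fun v => G (v 0))
    {f : (ℕ → M) → M} (hf : DefF f) : DefF fun v => G (f v) :=
  ⟨DefP.subst (q := fun v x => v 0 = G x)
    (h.out.reindex fun n => Nat.casesOn n 1 fun _ => 0) (hf.reindex _)⟩

theorem DefF.subst₂ {G : M → M → M} (h : DefF fun v => G (v 0) (v 1))
    {f g : (ℕ → M) → M} (hf : DefF f) (hg : DefF g) : DefF fun v => G (f v) (g v) :=
  ⟨DefP.subst₃ (C := fun z x y => z = G x y) h.out (DefF.var 0) (hf.reindex _) (hg.reindex _)⟩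

instance DefP.eq {f g : (ℕ → M) → M} [hf : DefF f] [hg : DefF g] : DefP fun v => f v = g v :=
  DefP.subst₂ (defP_eq_var 0 1) hf hg

instance DefP.mem {f g : (ℕ → M) → M} [hf : DefF f] [hg : DefF g] : DefP fun v => f v ∊ g v :=
  DefP.subst₂ (defP_mem_var 0 1) hf hg

instance DefP.isUPair {f g k : (ℕ → M) → M} [hf : DefF f] [hg : DefF g] [hk : DefF k] :
    DefP fun v => IsUPair (f v) (g v) (k v) :=
  DefP.subst₃ (by unfold IsUPair; infer_instance) hf hg hk

instance DefP.isOPair {f g k : (ℕ → M) → M} [hf : DefF f] [hg : DefF g] [hk : DefF k] :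
    DefP fun v => IsOPair (f v) (g v) (k v) :=
  DefP.subst₃ (by unfold IsOPair; infer_instance) hf hg hk

instance DefP.pairMem {f g k : (ℕ → M) → M} [hf : DefF f] [hg : DefF g] [hk : DefF k] :
    DefP fun v => PairMem (f v) (g v) (k v) :=
  DefP.subst₃ (by unfold PairMem; infer_instance) hf hg hk

instance DefP.tripleMem {f g k l : (ℕ → M) → M} [hf : DefF f] [hg : DefF g] [hk : DefF k]
    [hl : DefF l] : DefP fun v => TripleMem (f v) (g v) (k v) (l v) :=
  DefP.subst₄ (by unfold TripleMem; infer_instance) hf hg hk hl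

instance DefP.nameClosed {f g : (ℕ → M) → M} [hf : DefF f] [hg : DefF g] :
    DefP fun v => NameClosed (f v) (g v) :=
  DefP.subst₂ (by unfold NameClosed; infer_instance) hf hg

instance DefP.isName {f g : (ℕ → M) → M} [hf : DefF f] [hg : DefF g] :
    DefP fun v => IsName (f v) (g v) :=
  DefP.subst₂ (by unfold IsName; infer_instance) hf hg

instance DefP.forcesEq (P R : M) {f g k : (ℕ → M) → M} [hf : DefF f] [hg : DefF g] [hk : DefF k] :
    DefP fun v => ForcesEq P R (f v) (g v) (k v) :=
  DefP.subst₃ (by unfold ForcesEq EqClause; infer_instance) hf hg hk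

instance DefP.forcesMem (P R : M) {f g k : (ℕ → M) → M} [hf : DefF f] [hg : DefF g]
    [hk : DefF k] : DefP fun v => ForcesMem P R (f v) (g v) (k v) :=
  DefP.subst₃ (by unfold ForcesMem; infer_instance) hf hg hk

end Definability

/-! ### Basic set existence and set-builder terms inside `M` -/

section Sets

variable {M : Type u} [LSet.Structure M]

/-- The class `C` is (the extension of) a set of `M`. -/
def IsSet (C : M → Prop) : Prop :=
  ∃ a : M, ∀ x, x ∊ a ↔ C x

theorem isSet_mem (a : M) : IsSet fun x => x ∊ a :=
  ⟨a, fun _ => Iff.rfl⟩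

theorem IsSet.congr {C D : M → Prop} (h : IsSet C) (hCD : ∀ x, C x ↔ D x) : IsSet D := by
  obtain ⟨a, ha⟩ := h
  exact ⟨a, fun x => (ha x).trans (hCD x)⟩

variable [hM : Fact (IsModelZF M)]

theorem ext {a b : M} (h : ∀ x, x ∊ a ↔ x ∊ b) : a = b :=
  hM.out.extensionality a b h

theorem IsSet.inter {C : M → Prop} (h : IsSet C) (D : M → Prop) [hD : DefP fun v => D (v 0)] :
    IsSet fun x => C x ∧ D x := by
  obtain ⟨a, ha⟩ := h
  obtain ⟨φ, hφ⟩ := hD.out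
  obtain ⟨b, hb⟩ := hM.out.separation (Set.ofPred D) (by
    rw [Set.Definable₁, Set.definable_iff_exists_formula_sum]
    refine ⟨φ.relabel (Sum.map (fun x => ⟨x, Set.mem_univ x⟩) fun _ => 0), ?_⟩
    ext v
    refine Iff.trans ?_ Formula.realize_relabel.symm
    refine Iff.trans (hφ fun _ => v 0).symm (iff_of_eq (congrArg _ ?_))
    funext x
    cases x <;> rfl) a
  exact ⟨b, fun x => (hb x).trans (and_congr_left fun _ => ha x)⟩

theorem IsSet.sep (a : M) (D : M → Prop) [DefP fun v => D (v 0)] :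
    IsSet fun x => x ∊ a ∧ D x :=
  (isSet_mem a).inter D

theorem IsSet.subset {C D : M → Prop} (h : IsSet C) [DefP fun v => D (v 0)]
    (hDC : ∀ x, D x → C x) : IsSet D :=
  (h.inter D).congr fun x => ⟨fun h => h.2, fun h => ⟨hDC x h, h⟩⟩

theorem isSet_false : IsSet fun _ : M => False := by
  obtain ⟨w, -⟩ := hM.out.infinity
  exact (IsSet.sep w fun _ => False).congr fun x => by simp

theorem IsSet.pair (a b : M) : IsSet fun x => x = a ∨ x = b :=
  hM.out.pairing a b

theorem IsSet.singleton (a : M) : IsSet fun x => x = a :=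
  (IsSet.pair a a).congr fun _ => or_self_iff

theorem IsSet.sUnion {C : M → Prop} (h : IsSet C) : IsSet fun x => ∃ y, C y ∧ x ∊ y := by
  obtain ⟨a, ha⟩ := h
  obtain ⟨b, hb⟩ := hM.out.union a
  exact ⟨b, fun x => (hb x).trans (exists_congr fun y => and_congr_left fun _ => ha y)⟩

theorem IsSet.or {C D : M → Prop} (hC : IsSet C) (hD : IsSet D) : IsSet fun x => C x ∨ D x := by
  obtain ⟨a, ha⟩ := hC
  obtain ⟨b, hb⟩ := hD
  refine (IsSet.pair a b).sUnion.congr fun x => ?_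
  rw [← ha, ← hb]
  constructor
  · rintro ⟨y, rfl | rfl, h⟩
    exacts [Or.inl h, Or.inr h]
  · rintro (h | h)
    exacts [⟨a, Or.inl rfl, h⟩, ⟨b, Or.inr rfl, h⟩]

theorem IsSet.replacement {C : M → Prop} (hC : IsSet C) (F : M → M → Prop)
    [hF : DefP fun v => F (v 0) (v 1)] (h : ∀ x, C x → ∃! y, F x y) :
    IsSet fun y => ∃ x, C x ∧ F x y := by
  obtain ⟨a, ha⟩ := hC
  obtain ⟨φ, hφ⟩ := hF.out
  obtain ⟨b, hb⟩ := hM.out.replacement (Set.ofPred fun z => F z.1 z.2) (by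
    rw [Set.Definable₂, Set.definable_iff_exists_formula_sum]
    refine ⟨φ.relabel (Sum.map (fun x => ⟨x, Set.mem_univ x⟩) fun n => Nat.casesOn n 0 fun _ => 1), ?_⟩
    ext v
    refine Iff.trans ?_ Formula.realize_relabel.symm
    let w : ℕ → M := fun n => Nat.casesOn n (v 0) fun _ => v 1
    refine Iff.trans (show F (w 0) (w 1) ↔ _ from (hφ w).symm)
      (iff_of_eq (congrArg _ ?_))
    funext x
    rcases x with x | n
    · rfl
    · cases n <;> rfl) a fun x hx => h x ((ha x).1 hx)
  exact ⟨b, fun y => (hb y).trans (exists_congr fun x => and_congr_left fun _ => ha x)⟩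

open Classical in
/-- The set-builder operation: the set of all `x` with `C x` if there is one, and `∅` otherwise. -/
noncomputable def build (C : M → Prop) : M :=
  if h : IsSet C then h.choose else isSet_false.choose

theorem mem_build {C : M → Prop} (h : IsSet C) {x : M} : x ∊ build C ↔ C x := by
  rw [build, dif_pos h]
  exact h.choose_spec x

theorem eq_build {C : M → Prop} (h : IsSet C) {a : M} : a = build C ↔ ∀ x, x ∊ a ↔ C x :=
  ⟨fun e x => by rw [e, mem_build h], fun e => ext fun x => by rw [e, mem_build h]⟩

theorem build_congr {C D : M → Prop} (h : ∀ x, C x ↔ D x) : build C = build D := by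
  rw [show C = D from funext fun x => propext (h x)]

theorem build_mem (a : M) : build (fun x => x ∊ a) = a :=
  ((eq_build (isSet_mem a)).2 fun _ => Iff.rfl).symm

/-- The graph of `build` is definable because the default case is too: either the value has
extension `C v`, or no set does and the value is empty. -/
instance DefF.setBuilder {C : (ℕ → M) → M → Prop} [hC : DefP fun w => C (fun n => w (n + 1)) (w 0)] :
    DefF fun v => build (C v) := by
  have h : DefP fun w : ℕ → M => C (fun n => w (n + 1 + 1)) (w 0) :=
    hC.reindex fun n => Nat.casesOn n 0 fun k => k + 2
  have h' : DefP fun w : ℕ → M => C (fun n => w (n + 1 + 1 + 1)) (w 0) :=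
    hC.reindex fun n => Nat.casesOn n 0 fun k => k + 3
  have h₁ : DefP fun v : ℕ → M => ∀ x, x ∊ v 0 ↔ C (fun n => v (n + 1)) x :=
    @DefP.all _ _ _ (@DefP.iff _ _ _ _ inferInstance h)
  have h₂ : DefP fun v : ℕ → M => ∃ a, ∀ x, x ∊ a ↔ C (fun n => v (n + 1)) x :=
    @DefP.ex _ _ _ (@DefP.all _ _ _ (@DefP.iff _ _ _ _ inferInstance h'))
  refine ⟨DefP.congr (p := fun v => (∀ x, x ∊ v 0 ↔ C (fun n => v (n + 1)) x) ∨
    (¬ ∃ a, ∀ x, x ∊ a ↔ C (fun n => v (n + 1)) x) ∧ ∀ x, ¬ x ∊ v 0) inferInstance fun v => ?_⟩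
  by_cases hs : IsSet (C fun n => v (n + 1))
  · rw [eq_build hs]
    exact or_iff_left fun h => h.1 hs
  · rw [build, dif_neg hs]
    constructor
    · rintro (h | h)
      · exact absurd ⟨_, h⟩ hs
      · exact ext fun x => iff_of_false (h.2 x) (isSet_false.choose_spec x).1
    · intro h
      exact Or.inr ⟨hs, fun x hx => (isSet_false.choose_spec x).1 (h ▸ hx)⟩

theorem IsSet.image {C : M → Prop} (hC : IsSet C) (F : M → M) [DefF fun v => F (v 0)] :
    IsSet fun y => ∃ x, C x ∧ y = F x := by
  have : DefF fun v : ℕ → M => F (v 0) := inferInstance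
  have : DefP fun v : ℕ → M => v 1 = F (v 0) := @DefP.eq _ _ _ _ _ this
  exact hC.replacement (fun x y => y = F x) fun x _ => ⟨F x, rfl, fun _ h => h⟩

/-- Replacement along `x ↦ build (D x)`, followed by Union. -/
theorem IsSet.biUnion {C : M → Prop} (hC : IsSet C) (D : M → M → Prop)
    [hD : DefP fun v => D (v 1) (v 0)] (h : ∀ x, C x → IsSet (D x)) :
    IsSet fun y => ∃ x, C x ∧ D x y := by
  have : DefP fun v : ℕ → M => D (v (0 + 1)) (v 0) := hD
  have : DefF fun v : ℕ → M => build (D (v 0)) := DefF.setBuilder (C := fun v => D (v 0))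
  refine (hC.image fun x => build (D x)).sUnion.congr fun y => ?_
  constructor
  · rintro ⟨_, ⟨x, hx, rfl⟩, hy⟩
    exact ⟨x, hx, (mem_build (h x hx)).1 hy⟩
  · rintro ⟨x, hx, hy⟩
    exact ⟨_, ⟨x, hx, rfl⟩, (mem_build (h x hx)).2 hy⟩

theorem IsSet.powerset (a : M) : IsSet fun x => ∀ y, y ∊ x → y ∊ a :=
  hM.out.powerset a

/-- The ordered pair `⟨x, y⟩`. -/
noncomputable def opair (x y : M) : M :=
  build fun w => IsUPair w x x ∨ IsUPair w x y

instance DefF.opair {f g : (ℕ → M) → M} [hf : DefF f] [hg : DefF g] :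
    DefF fun v => opair (f v) (g v) :=
  DefF.subst₂ (by unfold MaxPrinciple.opair; infer_instance) hf hg

theorem isUPair_iff {w x y : M} : IsUPair w x y ↔ w = build fun u => u = x ∨ u = y :=
  (eq_build (IsSet.pair x y)).symm

theorem isOPair_iff {z x y : M} : IsOPair z x y ↔ z = opair x y := by
  rw [opair, eq_build]
  · rfl
  · exact (IsSet.pair _ _).congr fun w => or_congr isUPair_iff.symm isUPair_iff.symm

theorem isOPair_opair (x y : M) : IsOPair (opair x y) x y :=
  isOPair_iff.2 rfl

theorem pairMem_iff {x y f : M} : PairMem x y f ↔ opair x y ∊ f := by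
  simp only [PairMem, isOPair_iff, exists_eq_left]

theorem tripleMem_iff {p x y f : M} : TripleMem p x y f ↔ opair p (opair x y) ∊ f := by
  simp only [TripleMem, isOPair_iff, exists_eq_left, pairMem_iff]

theorem mem_opair_right (x y : M) : ∃ u, u ∊ opair x y ∧ y ∊ u :=
  ⟨_, (isOPair_opair x y _).2 (Or.inr (isUPair_iff.2 rfl)),
    (mem_build (IsSet.pair x y)).2 (Or.inr rfl)⟩

theorem opair_inj {x y x' y' : M} : opair x y = opair x' y' ↔ x = x' ∧ y = y' := by
  refine ⟨fun h => ?_, fun h => by rw [h.1, h.2]⟩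
  have key : ∀ w, IsUPair w x x ∨ IsUPair w x y ↔ IsUPair w x' x' ∨ IsUPair w x' y' := fun w => by
    rw [← isOPair_opair x y w, ← isOPair_opair x' y' w, h]
  have hs : ∀ a b : M, IsUPair (build fun u => u = a ∨ u = b) a b := fun a b => isUPair_iff.2 rfl
  have hx : x = x' := by
    rcases (key _).1 (Or.inl (hs x x)) with h | h
    · exact ((h x').2 (Or.inl rfl) |> (hs x x x').1).elim Eq.symm Eq.symm
    · exact ((h x').2 (Or.inl rfl) |> (hs x x x').1).elim Eq.symm Eq.symm
  subst hx
  refine ⟨rfl, ?_⟩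
  have h1 : y = x ∨ y = y' := by
    rcases (key _).1 (Or.inr (hs x y)) with h | h
    · exact Or.inl (((h y).1 ((hs x y y).2 (Or.inr rfl))).elim id id)
    · exact (h y).1 ((hs x y y).2 (Or.inr rfl))
  have h2 : y' = x ∨ y' = y := by
    rcases (key _).2 (Or.inr (hs x y')) with h | h
    · exact Or.inl (((h y').1 ((hs x y' y').2 (Or.inr rfl))).elim id id)
    · exact (h y').1 ((hs x y' y').2 (Or.inr rfl))
  rcases h1 with h1 | h1
  · rcases h2 with h2 | h2
    · rw [h1, h2]
    · exact h2.symm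
  · exact h1

theorem IsSet.prod (a b : M) : IsSet fun z => ∃ x, x ∊ a ∧ ∃ y, y ∊ b ∧ z = opair x y :=
  (isSet_mem a).biUnion (fun x z => ∃ y, y ∊ b ∧ z = MaxPrinciple.opair x y)
    fun x _ => (isSet_mem b).image fun y => MaxPrinciple.opair x y

end Sets

/-! ### Transitive closures, ∈-induction and ∈-recursion -/

section Recursion

variable {M : Type u} [LSet.Structure M] [hM : Fact (IsModelZF M)]

theorem exists_minimal_of_mem (C : M → Prop) [DefP fun v => C (v 0)] {a x : M} (hx : x ∊ a)
    (hC : C x) : ∃ m, m ∊ a ∧ C m ∧ ∀ y, y ∊ m → y ∊ a → ¬ C y := by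
  obtain ⟨b, hb⟩ := IsSet.sep a C
  obtain ⟨m, hm, h⟩ := hM.out.foundation b ⟨x, (hb x).2 ⟨hx, hC⟩⟩
  exact ⟨m, ((hb m).1 hm).1, ((hb m).1 hm).2, fun y hy hya hCy => h y hy ((hb y).2 ⟨hya, hCy⟩)⟩

theorem mem_irrefl (a : M) : ¬ a ∊ a := by
  intro h
  obtain ⟨m, hm, rfl, h'⟩ := exists_minimal_of_mem (fun x => x = a) h rfl
  exact h' _ h h rfl

theorem mem_asymm {a b : M} (h : a ∊ b) : ¬ b ∊ a := by
  intro h'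
  obtain ⟨c, hc⟩ := IsSet.pair a b
  obtain ⟨m, hm, hmin⟩ := hM.out.foundation c ⟨a, (hc a).2 (Or.inl rfl)⟩
  rcases (hc m).1 hm with rfl | rfl
  · exact hmin b h' ((hc b).2 (Or.inr rfl))
  · exact hmin a h ((hc a).2 (Or.inl rfl))

/-- `x ∪ {x}`. -/
noncomputable def succ (x : M) : M :=
  build fun z => z ∊ x ∨ z = x

instance DefF.succ {f : (ℕ → M) → M} [hf : DefF f] : DefF fun v => succ (f v) :=
  DefF.subst₁ (by unfold MaxPrinciple.succ; infer_instance) hf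

theorem mem_succ {z x : M} : z ∊ succ x ↔ z ∊ x ∨ z = x :=
  mem_build ((isSet_mem x).or (IsSet.singleton x))

theorem succ_inj {x y : M} (h : succ x = succ y) : x = y := by
  by_contra hne
  have h1 : x ∊ y := (mem_succ.1 (h ▸ mem_succ.2 (Or.inr rfl) : x ∊ succ y)).resolve_right hne
  have h2 : y ∊ x :=
    (mem_succ.1 (h ▸ mem_succ.2 (Or.inr rfl) : y ∊ succ x)).resolve_right (Ne.symm hne)
  exact mem_asymm h1 h2

/-- `w` contains `∅` and is closed under successors. -/
def Inductive (w : M) : Prop :=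
  (∀ e, (∀ x, ¬ x ∊ e) → e ∊ w) ∧ ∀ x, x ∊ w → succ x ∊ w

instance DefP.inductive {f : (ℕ → M) → M} [hf : DefF f] : DefP fun v => Inductive (f v) :=
  DefP.subst₁ (by unfold Inductive; infer_instance) hf

theorem exists_inductive : ∃ w : M, Inductive w := by
  obtain ⟨w, ⟨e, he, hempty⟩, hs⟩ := hM.out.infinity
  refine ⟨w, fun e' he' => ?_, fun x hx => ?_⟩
  · rwa [ext fun x => iff_of_false (he' x) (hempty x)]
  · obtain ⟨y, hy, h⟩ := hs x hx
    rwa [ext fun z => mem_succ.trans (h z).symm]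

/-- `n` is a natural number of `M`. -/
def IsNat (n : M) : Prop :=
  ∀ w, Inductive w → n ∊ w

instance DefP.isNat {f : (ℕ → M) → M} [hf : DefF f] : DefP fun v => IsNat (f v) :=
  DefP.subst₁ (by unfold IsNat; infer_instance) hf

theorem isSet_isNat : IsSet (IsNat : M → Prop) := by
  obtain ⟨w, hw⟩ := exists_inductive (M := M)
  exact (isSet_mem w).subset fun x hx => hx w hw

theorem IsNat.succ {n : M} (h : IsNat n) : IsNat (succ n) :=
  fun w hw => hw.2 _ (h w hw)

theorem IsNat.induction (C : M → Prop) [DefP fun v => C (v 0)]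
    (zero : ∀ e, (∀ x, ¬ x ∊ e) → C e) (step : ∀ n, IsNat n → C n → C (MaxPrinciple.succ n)) {n : M}
    (hn : IsNat n) : C n := by
  obtain ⟨w, hw⟩ := (isSet_isNat (M := M)).inter C
  exact ((hw n).1 (hn w ⟨fun e he => (hw e).2 ⟨fun w hw => hw.1 e he, zero e he⟩,
    fun x hx => (hw _).2 ⟨((hw x).1 hx).1.succ, step x ((hw x).1 hx).1 ((hw x).1 hx).2⟩⟩)).2

/-- `t` is a transitive set. -/
def Trans (t : M) : Prop :=
  ∀ x, x ∊ t → ∀ y, y ∊ x → y ∊ t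

/-- `g` consists of pairs `⟨n, ⋃ⁿ a⟩`, and is closed under predecessors of `n`. -/
def UnionApprox (a g : M) : Prop :=
  ∀ k v, opair k v ∊ g → ((∀ x, ¬ x ∊ k) ∧ v = a) ∨
    ∃ j w, k = succ j ∧ opair j w ∊ g ∧ v = build fun x => ∃ y, y ∊ w ∧ x ∊ y

instance DefP.unionApprox {f g : (ℕ → M) → M} [hf : DefF f] [hg : DefF g] :
    DefP fun v => UnionApprox (f v) (g v) :=
  DefP.subst₂ (by unfold UnionApprox; infer_instance) hf hg

theorem UnionApprox.unique {a n : M} (hn : IsNat n) : ∀ g g' u u', UnionApprox a g →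
    UnionApprox a g' → opair n u ∊ g → opair n u' ∊ g' → u = u' := by
  refine hn.induction (fun n => ∀ g g' u u', UnionApprox a g →
    UnionApprox a g' → opair n u ∊ g → opair n u' ∊ g' → u = u') ?_ ?_
  · intro e he g g' u u' hg hg' hu hu'
    have key : ∀ g u, UnionApprox a g → opair e u ∊ g → u = a := by
      intro g u hg hu
      rcases hg e u hu with h | ⟨j, w, rfl, -⟩
      · exact h.2
      · exact absurd (mem_succ.2 (Or.inr rfl)) (he j)
    rw [key g u hg hu, key g' u' hg' hu']
  · intro n _ ih g g' u u' hg hg' hu hu'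
    have key : ∀ g u, UnionApprox a g → opair (MaxPrinciple.succ n) u ∊ g →
        ∃ w, opair n w ∊ g ∧ u = build fun x => ∃ y, y ∊ w ∧ x ∊ y := by
      intro g u hg hu
      rcases hg _ u hu with h | ⟨j, w, hj, hw, rfl⟩
      · exact absurd (mem_succ.2 (Or.inr rfl)) (h.1 n)
      · rw [succ_inj hj]
        exact ⟨w, hw, rfl⟩
    obtain ⟨w, hw, rfl⟩ := key g u hg hu
    obtain ⟨w', hw', rfl⟩ := key g' u' hg' hu'
    rw [ih g g' w w' hg hg' hw hw']

/-- The witness is the union of the iterated unions `⋃ⁿ {a}` over the natural numbers `n` of `M`.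
Induction gives an approximation reaching each `n`, and its uniqueness permits Replacement. -/
theorem exists_trans (a : M) : ∃ t : M, Trans t ∧ a ∊ t := by
  obtain ⟨b, hb⟩ := IsSet.singleton a
  let T : M → M → Prop := fun n u => ∃ g, UnionApprox b g ∧ opair n u ∊ g
  have hex : ∀ n, IsNat n → ∃ u, T n u := by
    intro n hn
    refine hn.induction (fun n => ∃ u g, UnionApprox b g ∧ opair n u ∊ g) ?_ ?_
    · intro e he
      obtain ⟨g, hg⟩ := IsSet.singleton (opair e b)
      refine ⟨b, g, fun k v h => ?_, (hg _).2 rfl⟩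
      obtain ⟨rfl, rfl⟩ := opair_inj.1 ((hg _).1 h)
      exact Or.inl ⟨he, rfl⟩
    · rintro n - ⟨u, g, hg, hu⟩
      let u' := build fun x => ∃ y, y ∊ u ∧ x ∊ y
      obtain ⟨g', hg'⟩ := (isSet_mem g).or (IsSet.singleton (opair (succ n) u'))
      refine ⟨u', g', fun k v h => ?_, (hg' _).2 (Or.inr rfl)⟩
      rcases (hg' _).1 h with h | h
      · rcases hg k v h with h | ⟨j, w, hj, hw, hv⟩
        · exact Or.inl h
        · exact Or.inr ⟨j, w, hj, (hg' _).2 (Or.inl hw), hv⟩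
      · obtain ⟨rfl, rfl⟩ := opair_inj.1 h
        exact Or.inr ⟨n, u, rfl, (hg' _).2 (Or.inl hu), rfl⟩
  have hset : IsSet fun x => ∃ u, (∃ n, IsNat n ∧ T n u) ∧ x ∊ u :=
    (isSet_isNat.replacement T fun n hn => by
      obtain ⟨u, hu⟩ := hex n hn
      refine ⟨u, hu, fun u' hu' => ?_⟩
      obtain ⟨g, hg, h⟩ := hu
      obtain ⟨g', hg', h'⟩ := hu'
      exact UnionApprox.unique hn g' g u' u hg' hg h' h).sUnion
  obtain ⟨t, ht⟩ := hset
  refine ⟨t, fun x hx y hy => ?_, ?_⟩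
  · obtain ⟨u, ⟨n, hn, g, hg, h⟩, hxu⟩ := (ht x).1 hx
    let u' := build fun x => ∃ y, y ∊ u ∧ x ∊ y
    obtain ⟨v, g', hg', hv⟩ := hex _ hn.succ
    refine (ht y).2 ⟨v, ⟨_, hn.succ, g', hg', hv⟩, ?_⟩
    rcases hg' _ _ hv with h' | ⟨j, w, hj, hw, rfl⟩
    · exact absurd (mem_succ.2 (Or.inr rfl)) (h'.1 n)
    · rw [← succ_inj hj] at hw
      rw [UnionApprox.unique hn _ _ _ _ hg' hg hw h, mem_build (isSet_mem u).sUnion]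
      exact ⟨x, hxu, hy⟩
  · obtain ⟨e, he⟩ := isSet_false (M := M)
    have hn : IsNat e := fun w hw => hw.1 e fun x => (he x).1
    obtain ⟨u, g, hg, hu⟩ := hex e hn
    refine (ht a).2 ⟨u, ⟨e, hn, g, hg, hu⟩, ?_⟩
    rcases hg _ _ hu with h | ⟨j, w, rfl, -⟩
    · rw [h.2, hb]
    · exact absurd (mem_succ.2 (Or.inr rfl)) (he j).1

/-- Foundation for classes: inside a transitive set containing `x`, minimality within the set is
minimality in the whole class. -/
theorem exists_minimal (C : M → Prop) [DefP fun v => C (v 0)] {x : M} (hC : C x) :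
    ∃ m, C m ∧ ∀ y, y ∊ m → ¬ C y := by
  obtain ⟨t, ht, hx⟩ := exists_trans x
  obtain ⟨m, hm, hCm, h⟩ := exists_minimal_of_mem C hx hC
  exact ⟨m, hCm, fun y hy => h y hy (ht m hm y hy)⟩

theorem mem_induction (C : M → Prop) [DefP fun v => C (v 0)]
    (h : ∀ x, (∀ y, y ∊ x → C y) → C x) (x : M) : C x := by
  by_contra hx
  obtain ⟨m, hm, hmin⟩ := exists_minimal (fun x => ¬ C x) hx
  exact hm (h m fun y hy => not_not.1 (hmin y hy))

/-- Induction along the relation "`⟨s, π⟩ ∈ a` for some `s`". -/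
theorem name_induction (C : M → Prop) [hC : DefP fun v => C (v 0)]
    (h : ∀ a, (∀ s π, PairMem s π a → C π) → C a) (a : M) : C a := by
  have hC' : ∀ n : ℕ, DefP fun v : ℕ → M => C (v n) := fun n => DefP.subst₁ hC (DefF.var n)
  -- The name `π` lies three membership steps below `a`, as `π ∈ u ∈ ⟨s, π⟩ ∈ a`. The induction
  -- statement is therefore strengthened to cover two further levels.
  refine (mem_induction (fun a => C a ∧ (∀ u, u ∊ a → C u ∧ ∀ v, v ∊ u → C v)) ?_ a).1
  intro a ih
  refine ⟨h a fun s π hπ => ?_, fun u hu => ⟨(ih u hu).1, fun v hv => ((ih u hu).2 v hv).1⟩⟩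
  obtain ⟨u, hu, hπu⟩ := mem_opair_right s π
  exact ((ih _ (pairMem_iff.1 hπ)).2 u hu).2 π hπu

section

variable (H : M → M) [hH : DefF fun v => H (v 0)]

/-- `g` is an approximation to the function `F` with `F x = H {F z | z ∈ x}`. -/
def RecApprox (g : M) : Prop :=
  ∀ x c, opair x c ∊ g → (∀ z, z ∊ x → ∃ d, opair z d ∊ g) ∧
    c = H (build fun d => ∃ z, z ∊ x ∧ opair z d ∊ g)

instance DefP.recApprox {f : (ℕ → M) → M} [hf : DefF f] : DefP fun v => RecApprox H (f v) := by
  have : ∀ {f : (ℕ → M) → M} [DefF f], DefF fun v => H (f v) :=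
    fun {f} [hf : DefF f] => DefF.subst₁ hH hf
  exact DefP.subst₁ (by unfold RecApprox; infer_instance) hf

theorem RecApprox.unique (x : M) : ∀ g g' c c', RecApprox H g → RecApprox H g' →
    opair x c ∊ g → opair x c' ∊ g' → c = c' := by
  refine mem_induction (fun x => ∀ g g' c c', RecApprox H g → RecApprox H g' →
    opair x c ∊ g → opair x c' ∊ g' → c = c') (fun x ih g g' c c' hg hg' hc hc' => ?_) x
  obtain ⟨h1, rfl⟩ := hg x c hc
  obtain ⟨h2, rfl⟩ := hg' x c' hc'
  refine congrArg H (build_congr fun d => exists_congr fun z => and_congr_right fun hz => ?_)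
  obtain ⟨d₁, hd₁⟩ := h1 z hz
  obtain ⟨d₂, hd₂⟩ := h2 z hz
  constructor
  · intro h
    rwa [ih z hz g g' d d₂ hg hg' h hd₂]
  · intro h
    rwa [← ih z hz g g' d₁ d hg hg' hd₁ h]

/-- Approximations agree wherever both are defined, so being the value assigned by some
approximation is a definable relation; ∈-induction makes it total. -/
theorem exists_rec : ∃ F : M → M, (DefF fun v => F (v 0)) ∧
    ∀ x, F x = H (build fun d => ∃ z, z ∊ x ∧ d = F z) := by
  let Rec : M → M → Prop := fun x c => ∃ g, RecApprox H g ∧ opair x c ∊ g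
  have hu : ∀ x c c', Rec x c → Rec x c' → c = c' := by
    rintro x c c' ⟨g, hg, h⟩ ⟨g', hg', h'⟩
    exact RecApprox.unique H x g g' c c' hg hg' h h'
  have hsub : ∀ g, RecApprox H g → ∀ x, (∀ z, z ∊ x → ∃ d, opair z d ∊ g) →
      ∀ d, (∃ z, z ∊ x ∧ opair z d ∊ g) ↔ ∃ z, z ∊ x ∧ Rec z d := by
    refine fun g hg x hx d => exists_congr fun z => and_congr_right fun hz =>
      ⟨fun h => ⟨g, hg, h⟩, fun h => ?_⟩
    obtain ⟨d', hd'⟩ := hx z hz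
    rwa [hu z d d' h ⟨g, hg, hd'⟩]
  have hrec : ∀ x c, Rec x c → c = H (build fun d => ∃ z, z ∊ x ∧ Rec z d) := by
    rintro x c ⟨g, hg, h⟩
    obtain ⟨h1, rfl⟩ := hg x c h
    exact congrArg H (build_congr (hsub g hg x h1))
  have hex : ∀ x, ∃ c, Rec x c := by
    refine mem_induction (fun x => ∃ c, ∃ g, RecApprox H g ∧ opair x c ∊ g) fun x ih => ?_
    obtain ⟨t, ht, hxt⟩ := exists_trans x
    let c := H (build fun d => ∃ z, z ∊ x ∧ Rec z d)
    -- The new approximation gathers all values already available in the transitive set `t` and adds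
    -- the pair `⟨x, c⟩`. By the induction hypothesis every element of `x` has a value.
    obtain ⟨s, hs⟩ := (isSet_mem t).inter fun z => ∃ c, ∃ g, RecApprox H g ∧ opair z c ∊ g
    have hset : IsSet fun y => ∃ z, z ∊ s ∧ ∃ c, y = opair z c ∧ Rec z c :=
      (isSet_mem s).replacement
        (fun z y => ∃ c, y = opair z c ∧ ∃ g, RecApprox H g ∧ opair z c ∊ g) fun z hz => by
        obtain ⟨c, hc⟩ := ((hs z).1 hz).2
        refine ⟨_, ⟨c, rfl, hc⟩, ?_⟩
        rintro _ ⟨c', rfl, hc'⟩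
        rw [hu z c' c hc' hc]
    obtain ⟨g, hg⟩ := hset.or (IsSet.singleton (opair x c))
    have hmem : ∀ z d, z ∊ t → Rec z d → opair z d ∊ g := fun z d hz hd =>
      (hg _).2 (Or.inl ⟨z, (hs z).2 ⟨hz, d, hd⟩, d, rfl, hd⟩)
    have hmem' : ∀ z d, opair z d ∊ g → z ∊ t ∧
        d = H (build fun d => ∃ w, w ∊ z ∧ Rec w d) ∧ ∀ w, w ∊ z → ∃ d, Rec w d := by
      intro z d h
      rcases (hg _).1 h with ⟨z', hz', d', h, hd'⟩ | h
      · obtain ⟨rfl, rfl⟩ := opair_inj.1 h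
        refine ⟨((hs z).1 hz').1, hrec z d hd', fun w hw => ?_⟩
        obtain ⟨g₀, hg₀, h₀⟩ := hd'
        obtain ⟨e, he⟩ := (hg₀ z d h₀).1 w hw
        exact ⟨e, g₀, hg₀, he⟩
      · obtain ⟨rfl, rfl⟩ := opair_inj.1 h
        exact ⟨hxt, rfl, ih⟩
    refine ⟨c, g, fun z d hzd => ?_, (hg _).2 (Or.inr rfl)⟩
    obtain ⟨hz, rfl, hw⟩ := hmem' z d hzd
    refine ⟨fun w hwz => (hw w hwz).imp fun e he => hmem w e (ht z hz w hwz) he,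
      congrArg H (build_congr fun e => exists_congr fun w => and_congr_right fun hwz =>
        ⟨hmem w e (ht z hz w hwz), fun hwe => ?_⟩)⟩
    obtain ⟨e', he'⟩ := hw w hwz
    rwa [(hmem' w e hwe).2.1, ← hrec w e' he']
  choose F hF using hex
  have hFiff : ∀ x c, c = F x ↔ Rec x c :=
    fun x c => ⟨fun h => h ▸ hF x, fun h => hu x c _ h (hF x)⟩
  refine ⟨F, ⟨DefP.congr (p := fun v => Rec (v 1) (v 0)) (by unfold Rec; infer_instance)
    fun v => (hFiff _ _).symm⟩, fun x => ?_⟩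
  rw [hrec x _ (hF x)]
  exact congrArg H (build_congr fun d => exists_congr fun z => and_congr_right fun _ =>
    (hFiff z d).symm)

end

end Recursion

/-! ### A rank hierarchy without ordinals, and Scott's trick -/

section Hierarchy

variable {M : Type u} [LSet.Structure M] [hM : Fact (IsModelZF M)]

/-- The cumulative hierarchy indexed by all sets: `V x = ⋃ {𝒫 (V z) | z ∈ x}`. -/
theorem exists_hierarchy : ∃ V : M → M, (DefF fun v => V (v 0)) ∧
    ∀ x y, y ∊ V x ↔ ∃ z, z ∊ x ∧ ∀ u, u ∊ y → u ∊ V z := by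
  let H : M → M := fun s => build fun y => ∃ t, t ∊ s ∧ ∀ u, u ∊ y → u ∊ t
  have : DefF fun v : ℕ → M => H (v 0) := by unfold H; infer_instance
  obtain ⟨V, hV, h⟩ := exists_rec H
  refine ⟨V, hV, fun x y => ?_⟩
  have hs : IsSet fun d => ∃ z, z ∊ x ∧ d = V z := (isSet_mem x).image V
  rw [h x, mem_build ((isSet_mem _).biUnion (fun t y => ∀ u, u ∊ y → u ∊ t)
    fun t _ => IsSet.powerset t)]
  simp only [mem_build hs]
  constructor
  · rintro ⟨_, ⟨z, hz, rfl⟩, h⟩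
    exact ⟨z, hz, h⟩
  · rintro ⟨z, hz, h⟩
    exact ⟨_, ⟨z, hz, rfl⟩, h⟩

/-- Comparability of ranks. Both orientations are proved together by induction on `y`: the second
for elements of `y` yields the first for `y`, which in turn yields the second. -/
theorem hierarchy_linear {V : M → M} [hV : DefF fun v => V (v 0)]
    (h : ∀ x y, y ∊ V x ↔ ∃ z, z ∊ x ∧ ∀ u, u ∊ y → u ∊ V z) (x y : M) :
    V x ∊ V y ∨ ∀ u, u ∊ V y → u ∊ V x := by
  have hV' : ∀ {f : (ℕ → M) → M} [DefF f], DefF fun v => V (f v) :=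
    fun {f} [hf : DefF f] => DefF.subst₁ hV hf
  have key : ∀ x y, (∀ z, z ∊ y → V z ∊ V x ∨ ∀ u, u ∊ V x → u ∊ V z) →
      V x ∊ V y ∨ ∀ u, u ∊ V y → u ∊ V x := by
    intro x y ih
    by_cases hxy : ∃ z, z ∊ y ∧ ∀ u, u ∊ V x → u ∊ V z
    · exact Or.inl ((h y _).2 hxy)
    · right
      intro u hu
      obtain ⟨z, hz, huz⟩ := (h y u).1 hu
      rcases ih z hz with h' | h'
      · obtain ⟨t, ht, hzt⟩ := (h x _).1 h'
        exact (h x u).2 ⟨t, ht, fun w hw => hzt w (huz w hw)⟩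
      · exact absurd ⟨z, hz, h'⟩ hxy
  refine (mem_induction (fun y => ∀ x, (V x ∊ V y ∨ ∀ u, u ∊ V y → u ∊ V x) ∧
    (V y ∊ V x ∨ ∀ u, u ∊ V x → u ∊ V y)) (fun y ih => ?_) y x).1
  have h1 : ∀ x, V x ∊ V y ∨ ∀ u, u ∊ V y → u ∊ V x :=
    fun x => key x y fun z hz => (ih z hz x).2
  exact fun x => ⟨h1 x, key y x fun z _ => h1 z⟩

/-- Scott's trick: from a nonempty class one can definably select a nonempty subset. -/
theorem exists_scott (C : M → M → Prop) [hC : DefP fun v => C (v 0) (v 1)] :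
    ∃ S : M → M, (DefF fun v => S (v 0)) ∧ (∀ r τ, τ ∊ S r → C r τ) ∧
      ∀ r, (∃ τ, C r τ) → ∃ τ, τ ∊ S r := by
  obtain ⟨V, hV, h⟩ := exists_hierarchy (M := M)
  have hV' : ∀ {f : (ℕ → M) → M} [DefF f], DefF fun v => V (f v) :=
    fun {f} [hf : DefF f] => DefF.subst₁ hV hf
  have hC' : ∀ {f g : (ℕ → M) → M} [DefF f] [DefF g], DefP fun v => C (f v) (g v) :=
    fun {f g} [hf : DefF f] [hg : DefF g] => DefP.subst₂ hC hf hg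
  have hsub : ∀ x u, u ∊ x → u ∊ V x := by
    refine mem_induction (fun x => ∀ u, u ∊ x → u ∊ V x) fun x ih u hu => ?_
    exact (h x u).2 ⟨u, hu, ih u hu⟩
  -- The members of minimal rank. They form a set, since `τ' ⊆ V τ' ⊆ V τ` for any fixed minimal
  -- `τ`.
  let D : M → M → Prop := fun r τ => C r τ ∧ ∀ τ', C r τ' → ∀ u, u ∊ V τ → u ∊ V τ'
  have hD : ∀ r, IsSet (D r) := by
    intro r
    by_cases hr : ∃ τ, D r τ
    · obtain ⟨τ, hτ⟩ := hr
      refine (IsSet.powerset (V τ)).subset (D := fun τ' => C r τ' ∧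
        ∀ τ'', C r τ'' → ∀ u, u ∊ V τ' → u ∊ V τ'') fun τ' hτ' u hu => ?_
      exact hτ'.2 τ hτ.1 u (hsub τ' u hu)
    · exact isSet_false.congr fun τ => ⟨False.elim, fun h => hr ⟨τ, h⟩⟩
  refine ⟨fun r => build (D r), by unfold D; infer_instance,
    fun r τ hτ => ((mem_build (hD r)).1 hτ).1, fun r ⟨τ, hτ⟩ => ?_⟩
  obtain ⟨m, ⟨τ₀, h₀, rfl⟩, hmin⟩ := exists_minimal (fun m => ∃ τ, C r τ ∧ m = V τ) ⟨τ, hτ, rfl⟩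
  refine ⟨τ₀, (mem_build (hD r)).2 ⟨h₀, fun τ' hτ' => ?_⟩⟩
  exact (hierarchy_linear h τ' τ₀).resolve_left fun hmem => hmin _ hmem ⟨τ', hτ', rfl⟩

end Hierarchy

/-! ### Choice functions and Zermelo's well-ordering theorem -/

section Choice

variable {M : Type u} [LSet.Structure M] [hM : Fact (IsModelZF M)]

/-- Turns the set `f` into a total definable function: the union of all values of `f` at `x` is the
value itself when it is unique. -/
theorem exists_choice (hAC : AxiomOfChoice M) (a : M) :
    ∃ c : M → M, (DefF fun v => c (v 0)) ∧ ∀ x, x ∊ a → (∃ y, y ∊ x) → c x ∊ x := by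
  obtain ⟨b, hb⟩ := (isSet_mem a).inter fun x => ∃ y, y ∊ x
  obtain ⟨f, hf, hf'⟩ := hAC b fun x hx => ((hb x).1 hx).2
  refine ⟨fun x => build fun u => ∃ y, u ∊ y ∧ opair x y ∊ f, inferInstance, fun x hx hne => ?_⟩
  obtain ⟨y, hy, hu⟩ := hf' x ((hb x).2 ⟨hx, hne⟩)
  rw [pairMem_iff] at hy
  simp only [pairMem_iff] at hu
  have : build (fun u => ∃ y, u ∊ y ∧ opair x y ∊ f) = y := by
    rw [← build_mem y]
    refine build_congr fun u => ⟨?_, fun h => ⟨y, h, hy⟩⟩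
    rintro ⟨y', h, hy'⟩
    rwa [← hu y' hy']
  show build (fun u => ∃ y, u ∊ y ∧ opair x y ∊ f) ∊ x
  rw [this]
  obtain ⟨x', y', h, -, hxy⟩ := hf _ hy
  obtain ⟨rfl, rfl⟩ := opair_inj.1 (isOPair_iff.1 h)
  exact hxy

section Tower

variable (A : M) (s : M → M)

/-- The set `T` is closed under `s` and under unions. -/
def IsTower (T : M) : Prop :=
  (∀ Y, Y ∊ T → s Y ∊ T) ∧
    ∀ L, (∀ Y, Y ∊ L → Y ∊ T) → build (fun x => ∃ Y, Y ∊ L ∧ x ∊ Y) ∊ T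

/-- `Y` is a subset of `A` that belongs to every tower. -/
def InTower (Y : M) : Prop :=
  (∀ x, x ∊ Y → x ∊ A) ∧ ∀ T, IsTower s T → Y ∊ T

variable [hs : DefF fun v => s (v 0)]

instance DefP.inTower {f : (ℕ → M) → M} [hf : DefF f] : DefP fun v => InTower A s (f v) := by
  have : ∀ {f : (ℕ → M) → M} [DefF f], DefF fun v => s (f v) :=
    fun {f} [hf : DefF f] => DefF.subst₁ hs hf
  exact DefP.subst₁ (by unfold InTower IsTower; infer_instance) hf

variable {A s} (hsA : ∀ Y, (∀ x, x ∊ Y → x ∊ A) → ∀ x, x ∊ s Y → x ∊ A)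

omit hs in
include hsA in
theorem InTower.step {Y : M} (hY : InTower A s Y) : InTower A s (s Y) :=
  ⟨hsA Y hY.1, fun T hT => hT.1 Y (hY.2 T hT)⟩

omit hs in
theorem InTower.sUnion {L : M} (hL : ∀ Y, Y ∊ L → InTower A s Y) :
    InTower A s (build fun x => ∃ Y, Y ∊ L ∧ x ∊ Y) := by
  refine ⟨fun x hx => ?_, fun T hT => hT.2 L fun Y hY => (hL Y hY).2 T hT⟩
  obtain ⟨Y, hY, hxY⟩ := (mem_build (isSet_mem L).sUnion).1 hx
  exact (hL Y hY).1 x hxY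

include hsA in
theorem InTower.induction (C : M → Prop) [DefP fun v => C (v 0)]
    (step : ∀ Y, InTower A s Y → C Y → C (s Y))
    (sUnion : ∀ L, (∀ Y, Y ∊ L → InTower A s Y ∧ C Y) →
      C (build fun x => ∃ Y, Y ∊ L ∧ x ∊ Y)) {Y : M} (hY : InTower A s Y) : C Y := by
  obtain ⟨T, hT⟩ := ((IsSet.powerset A).subset (D := InTower A s) fun Y hY => hY.1).inter C
  exact ((hT Y).1 (hY.2 T ⟨fun Y hY => (hT _).2 ⟨((hT Y).1 hY).1.step hsA,
    step Y ((hT Y).1 hY).1 ((hT Y).1 hY).2⟩, fun L hL => (hT _).2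
    ⟨InTower.sUnion fun Y hY => ((hT Y).1 (hL Y hY)).1,
      sUnion L fun Y hY => (hT Y).1 (hL Y hY)⟩⟩)).2

include hsA in
-- The hypothesis on `Y` says that a step from a proper subset in the tower never leaves `Y`. Tower
-- induction on `Z` then shows that `Z` cannot pass `Y` without containing `s Y`.
theorem InTower.comparable_aux (hinc : ∀ Y x, x ∊ Y → x ∊ s Y) {Y : M}
    (hY : ∀ Z, InTower A s Z → (∀ x, x ∊ Z → x ∊ Y) → Z ≠ Y → ∀ x, x ∊ s Z → x ∊ Y)
    {Z : M} (hZ : InTower A s Z) : (∀ x, x ∊ Z → x ∊ Y) ∨ ∀ x, x ∊ s Y → x ∊ Z := by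
  refine hZ.induction hsA (fun Z => (∀ x, x ∊ Z → x ∊ Y) ∨ ∀ x, x ∊ s Y → x ∊ Z)
    (fun Z hZ ih => ?_) (fun L hL => ?_)
  · rcases ih with ih | ih
    · by_cases h : Z = Y
      · exact Or.inr fun x hx => h ▸ hx
      · exact Or.inl (hY Z hZ ih h)
    · exact Or.inr fun x hx => hinc _ _ (ih x hx)
  · simp only [mem_build (isSet_mem L).sUnion]
    by_cases h : ∃ Z, Z ∊ L ∧ ∀ x, x ∊ s Y → x ∊ Z
    · obtain ⟨Z, hZ, h⟩ := h
      exact Or.inr fun x hx => ⟨Z, hZ, h x hx⟩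
    · left
      rintro x ⟨Z, hZ, hx⟩
      exact (hL Z hZ).2.resolve_right (fun h' => h ⟨Z, hZ, h'⟩) x hx

include hsA in
-- Every tower member satisfies the hypothesis of `comparable_aux`, by a second tower induction, now
-- on `Y`.
theorem InTower.comparable (hinc : ∀ Y x, x ∊ Y → x ∊ s Y) {Y Z : M} (hY : InTower A s Y)
    (hZ : InTower A s Z) : (∀ x, x ∊ Z → x ∊ Y) ∨ ∀ x, x ∊ s Y → x ∊ Z := by
  have hs' : ∀ {f : (ℕ → M) → M} [DefF f], DefF fun v => s (f v) :=
    fun {f} [hf : DefF f] => DefF.subst₁ hs hf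
  refine InTower.comparable_aux hsA hinc ?_ hZ
  refine hY.induction hsA (fun Y => ∀ Z, InTower A s Z → (∀ x, x ∊ Z → x ∊ Y) → Z ≠ Y →
    ∀ x, x ∊ s Z → x ∊ Y) (fun Y hY ih Z hZ hZY hne x hx => ?_)
    (fun L hL Z hZ hZY hne x hx => ?_)
  · rcases InTower.comparable_aux hsA hinc ih hZ with h | h
    · by_cases h' : Z = Y
      · rwa [← h']
      · exact hinc _ _ (ih Z hZ h h' x hx)
    · exact absurd (ext fun x => ⟨hZY x, h x⟩) hne
  · simp only [mem_build (isSet_mem L).sUnion] at hZY ⊢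
    by_cases h : ∀ W, W ∊ L → ∀ x, x ∊ W → x ∊ Z
    · refine absurd (ext fun x => ?_) hne
      rw [mem_build (isSet_mem L).sUnion]
      exact ⟨hZY x, fun ⟨W, hW, hx⟩ => h W hW x hx⟩
    · push Not at h
      obtain ⟨W, hW, y, hyW, hyZ⟩ := h
      rcases InTower.comparable_aux hsA hinc (hL W hW).2 hZ with h | h
      · exact ⟨W, hW, (hL W hW).2 Z hZ h (fun e => hyZ (e ▸ hyW)) x hx⟩
      · exact absurd (h y (hinc _ _ hyW)) hyZ

end Tower

/-- The well-ordering theorem in `M`. -/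
theorem exists_wellOrder (hAC : AxiomOfChoice M) (A : M) :
    ∃ lt : M → M → Prop, (DefP fun v => lt (v 0) (v 1)) ∧
      (∀ x y, x ∊ A → y ∊ A → x ≠ y → lt x y ∨ lt y x) ∧
      ∀ B, (∀ x, x ∊ B → x ∊ A) → (∃ x, x ∊ B) → ∃ b, b ∊ B ∧ ∀ x, x ∊ B → ¬ lt x b := by
  obtain ⟨Q, hQ⟩ := IsSet.powerset A
  obtain ⟨c, hc, hc'⟩ := exists_choice hAC Q
  have hcd : ∀ {f : (ℕ → M) → M} [DefF f], DefF fun v => c (f v) :=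
    fun {f} [hf : DefF f] => DefF.subst₁ hc hf
  let diff : M → M := fun Y => build fun x => x ∊ A ∧ ¬ x ∊ Y
  have hdiff : ∀ Y x, x ∊ diff Y ↔ x ∊ A ∧ ¬ x ∊ Y := fun Y x => mem_build (IsSet.sep A _)
  -- Adjoin the chosen element of `A \ Y`. The guard `x ∊ A` keeps `s Y` inside `A` when `A \ Y` is
  -- empty and `c` returns an arbitrary value.
  let s : M → M := fun Y => build fun x => x ∊ Y ∨ x ∊ A ∧ x = c (diff Y)
  have hs : DefF fun v : ℕ → M => s (v 0) := by unfold s diff; infer_instance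
  have hmem : ∀ Y x, x ∊ s Y ↔ x ∊ Y ∨ x ∊ A ∧ x = c (diff Y) :=
    fun Y x => mem_build ((isSet_mem Y).or (IsSet.sep A _))
  have hsA : ∀ Y, (∀ x, x ∊ Y → x ∊ A) → ∀ x, x ∊ s Y → x ∊ A :=
    fun Y hY x hx => ((hmem Y x).1 hx).elim (hY x) And.left
  have hinc : ∀ Y x, x ∊ Y → x ∊ s Y := fun Y x hx => (hmem Y x).2 (Or.inl hx)
  -- For nonempty `B ⊆ A`, the largest `Y` in the tower disjoint from `B`.
  have key : ∀ B, (∀ x, x ∊ B → x ∊ A) → (∃ x, x ∊ B) → ∃ Y, InTower A s Y ∧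
      (∀ x, x ∊ B → ¬ x ∊ Y) ∧ ∃ b, b ∊ B ∧ ∀ x, x ∊ s Y ↔ x ∊ Y ∨ x = b := by
    rintro B hBA ⟨x₀, hx₀⟩
    obtain ⟨L, hL⟩ := ((IsSet.powerset A).subset (D := InTower A s) fun Y hY => hY.1).inter
      fun Y => ∀ x, x ∊ B → ¬ x ∊ Y
    let Y := build fun x => ∃ Y, Y ∊ L ∧ x ∊ Y
    have hY : InTower A s Y := InTower.sUnion fun Z hZ => ((hL Z).1 hZ).1
    have hYB : ∀ x, x ∊ B → ¬ x ∊ Y := by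
      intro x hx hxY
      obtain ⟨Z, hZ, hxZ⟩ := (mem_build (isSet_mem L).sUnion).1 hxY
      exact ((hL Z).1 hZ).2 x hx hxZ
    have hb : c (diff Y) ∊ diff Y := hc' _ ((hQ _).2 fun x hx => ((hdiff Y x).1 hx).1)
      ⟨x₀, (hdiff Y x₀).2 ⟨hBA x₀ hx₀, hYB x₀ hx₀⟩⟩
    rw [hdiff] at hb
    refine ⟨Y, hY, hYB, c (diff Y), ?_, fun x => ?_⟩
    -- Otherwise `s Y` would still be disjoint from `B`, hence contained in the largest such `Y`,
    -- although its new element is not in `Y`.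
    · by_contra hbB
      refine hb.2 ((mem_build (isSet_mem L).sUnion).2 ⟨s Y, (hL _).2 ⟨hY.step hsA,
        fun x hx hxs => ?_⟩, (hmem _ _).2 (Or.inr ⟨hb.1, rfl⟩)⟩)
      rcases (hmem Y x).1 hxs with h | h
      · exact hYB x hx h
      · exact hbB (h.2 ▸ hx)
    · rw [hmem]
      exact or_congr_right ⟨And.right, fun h => ⟨h ▸ hb.1, h⟩⟩
  -- `x` precedes `y` when `x` enters the tower at a stage that `y` has not reached. The least
  -- element of `B` is the one adjoined to the largest stage disjoint from `B`.
  refine ⟨fun x y => ∃ Y, InTower A s Y ∧ x ∊ Y ∧ ¬ y ∊ Y, inferInstance,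
    fun x y hx hy hne => ?_, fun B hBA hB => ?_⟩
  · obtain ⟨B, hB⟩ := IsSet.pair x y
    obtain ⟨Y, hY, hYB, b, hb, hsY⟩ := key B
      (fun z hz => ((hB z).1 hz).elim (fun h => h ▸ hx) fun h => h ▸ hy) ⟨x, (hB x).2 (Or.inl rfl)⟩
    have hx' := hYB x ((hB x).2 (Or.inl rfl))
    have hy' := hYB y ((hB y).2 (Or.inr rfl))
    rcases (hB b).1 hb with rfl | rfl
    · exact Or.inl ⟨s Y, hY.step hsA, (hsY b).2 (Or.inr rfl),
        fun h => ((hsY y).1 h).elim hy' fun e => hne e.symm⟩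
    · exact Or.inr ⟨s Y, hY.step hsA, (hsY b).2 (Or.inr rfl),
        fun h => ((hsY x).1 h).elim hx' fun e => hne e⟩
  · obtain ⟨Y, hY, hYB, b, hb, hsY⟩ := key B hBA hB
    refine ⟨b, hb, ?_⟩
    rintro x hx ⟨Z, hZ, hxZ, hbZ⟩
    rcases InTower.comparable hsA hinc hY hZ with h | h
    · exact hYB x hx (h x hxZ)
    · exact hbZ (h b ((hsY b).2 (Or.inr rfl)))

end Choice

/-! ### The forcing relation: recursion clause, monotonicity, density, congruence, definability -/

section Forcing

variable {M : Type u} [LSet.Structure M] [hM : Fact (IsModelZF M)] {P R : M}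

theorem NameClosed.union {D D' : M} (hD : NameClosed P D) (hD' : NameClosed P D') :
    ∃ E, NameClosed P E ∧ (∀ x, x ∊ D → x ∊ E) ∧ ∀ x, x ∊ D' → x ∊ E := by
  obtain ⟨E, hE⟩ := (isSet_mem D).or (isSet_mem D')
  refine ⟨E, fun a ha z hz => ?_, fun x hx => (hE x).2 (Or.inl hx),
    fun x hx => (hE x).2 (Or.inr hx)⟩
  rcases (hE a).1 ha with ha | ha
  · obtain ⟨s, π, h, hs, hπ⟩ := hD a ha z hz
    exact ⟨s, π, h, hs, (hE π).2 (Or.inl hπ)⟩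
  · obtain ⟨s, π, h, hs, hπ⟩ := hD' a ha z hz
    exact ⟨s, π, h, hs, (hE π).2 (Or.inr hπ)⟩

theorem NameClosed.mem {D a s π : M} (hD : NameClosed P D) (ha : a ∊ D) (h : PairMem s π a) :
    s ∊ P ∧ π ∊ D := by
  obtain ⟨s', π', h', hs, hπ⟩ := hD a ha _ (pairMem_iff.1 h)
  obtain ⟨rfl, rfl⟩ := opair_inj.1 (isOPair_iff.1 h')
  exact ⟨hs, hπ⟩

/-- For the converse, the names in a transitive set around `τ`, together with `τ`, form a
name-closed set. -/
theorem isName_iff {τ : M} : IsName P τ ↔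
    ∀ z, z ∊ τ → ∃ s π, z = opair s π ∧ s ∊ P ∧ IsName P π := by
  constructor
  · rintro ⟨D, hD, hτ⟩ z hz
    obtain ⟨s, π, h, hs, hπ⟩ := hD τ hτ z hz
    exact ⟨s, π, isOPair_iff.1 h, hs, D, hD, hπ⟩
  · intro h
    obtain ⟨t, ht, hτ⟩ := exists_trans τ
    obtain ⟨D, hD⟩ := (isSet_mem t).inter fun π => π = τ ∨ IsName P π
    refine ⟨D, fun a ha z hz => ?_, (hD τ).2 ⟨hτ, Or.inl rfl⟩⟩
    obtain ⟨s, π, rfl, hs, hπ⟩ : ∃ s π, z = opair s π ∧ s ∊ P ∧ IsName P π := by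
      rcases ((hD a).1 ha).2 with rfl | ⟨E, hE, haE⟩
      · exact h z hz
      · obtain ⟨s, π, h, hs, hπ⟩ := hE a haE z hz
        exact ⟨s, π, isOPair_iff.1 h, hs, E, hE, hπ⟩
    obtain ⟨u, hu, hπu⟩ := mem_opair_right s π
    exact ⟨s, π, isOPair_opair s π, hs,
      (hD π).2 ⟨ht u (ht _ (ht a ((hD a).1 ha).1 _ hz) u hu) π hπu, Or.inr hπ⟩⟩

theorem IsName.mem {s π τ : M} (hτ : IsName P τ) (h : PairMem s π τ) : s ∊ P ∧ IsName P π := by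
  obtain ⟨D, hD, hτD⟩ := hτ
  exact ⟨(hD.mem hτD h).1, D, hD, (hD.mem hτD h).2⟩

namespace IsPartialOrd

variable (hR : IsPartialOrd P R)

include hR

theorem mem_left {p q : M} (h : PairMem q p R) : q ∊ P := by
  obtain ⟨q', p', h', hq, -⟩ := hR.subset _ (pairMem_iff.1 h)
  rwa [(opair_inj.1 (isOPair_iff.1 h')).1]

theorem mem_right {p q : M} (h : PairMem q p R) : p ∊ P := by
  obtain ⟨q', p', h', -, hp⟩ := hR.subset _ (pairMem_iff.1 h)
  rwa [(opair_inj.1 (isOPair_iff.1 h')).2]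

end IsPartialOrd

theorem EqClause.imp (hR : IsPartialOrd P R) {E E' : M → M → M → Prop} {p σ τ : M}
    (h : EqClause R E p σ τ) (hE : ∀ r s π s' π', r ∊ P → PairMem s π σ → PairMem s' π' τ →
      E r π π' → E' r π π') : EqClause R E' p σ τ := by
  refine ⟨fun s π hπ q hqp hqs => ?_, fun s' π' hπ' q hqp hqs => ?_⟩
  · obtain ⟨r, hr, s', π', hπ', hrs', h⟩ := h.1 s π hπ q hqp hqs
    exact ⟨r, hr, s', π', hπ', hrs', hE r s π s' π' (hR.mem_left hr) hπ hπ' h⟩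
  · obtain ⟨r, hr, s, π, hπ, hrs, h⟩ := h.2 s' π' hπ' q hqp hqs
    exact ⟨r, hr, s, π, hπ, hrs, hE r s π s' π' (hR.mem_left hr) hπ hπ' h⟩

/-- `F` obeys the recursive clause for forcing equality on `D`. -/
def IsForcesEqOn (P R D F : M) : Prop :=
  ∀ q a b, q ∊ P → a ∊ D → b ∊ D →
    (TripleMem q a b F ↔ EqClause R (fun r π π' => TripleMem r π π' F) q a b)

/-- The relation of forcing equality on `D` is the greatest fixed point of the clause. -/
theorem exists_isForcesEqOn (hR : IsPartialOrd P R) {D : M} (hD : NameClosed P D) :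
    ∃ F, IsForcesEqOn P R D F := by
  -- Post-fixed points of the clause; `F` is their union, cut down to `P × (D × D)`.
  let Post : M → Prop := fun X => ∀ q a b, TripleMem q a b X →
    EqClause R (fun r π π' => TripleMem r π π' X) q a b
  have hPost : DefP fun v : ℕ → M => Post (v 0) := by
    unfold Post EqClause
    infer_instance
  have hPost' : ∀ {f : (ℕ → M) → M} [DefF f], DefP fun v => Post (f v) :=
    fun {f} [hf : DefF f] => DefP.subst₁ hPost hf
  obtain ⟨DD, hDD⟩ := IsSet.prod D D
  obtain ⟨F, hF⟩ := (IsSet.prod P DD).inter fun t => ∃ X, Post X ∧ t ∊ X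
  have hmem : ∀ q a b, q ∊ P → a ∊ D → b ∊ D →
      (TripleMem q a b F ↔ ∃ X, Post X ∧ TripleMem q a b X) := by
    intro q a b hq ha hb
    simp only [tripleMem_iff, hF]
    exact and_iff_right ⟨q, hq, _, (hDD _).2 ⟨a, ha, b, hb, rfl⟩, rfl⟩
  have hmem' : ∀ q a b, TripleMem q a b F → q ∊ P ∧ a ∊ D ∧ b ∊ D := by
    intro q a b h
    obtain ⟨⟨q', hq, w, hw, h⟩, -⟩ := (hF _).1 (tripleMem_iff.1 h)
    obtain ⟨rfl, rfl⟩ := opair_inj.1 h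
    obtain ⟨a', ha, b', hb, h⟩ := (hDD _).1 hw
    obtain ⟨rfl, rfl⟩ := opair_inj.1 h
    exact ⟨hq, ha, hb⟩
  have hpost : ∀ q a b, TripleMem q a b F →
      EqClause R (fun r π π' => TripleMem r π π' F) q a b := by
    intro q a b h
    obtain ⟨hq, ha, hb⟩ := hmem' q a b h
    obtain ⟨X, hX, h⟩ := (hmem q a b hq ha hb).1 h
    refine (hX q a b h).imp hR fun r s π s' π' hr hπ hπ' h => ?_
    exact (hmem r π π' hr (hD.mem ha hπ).2 (hD.mem hb hπ').2).2 ⟨X, hX, h⟩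
  refine ⟨F, fun q a b hq ha hb => ⟨hpost q a b, fun h => ?_⟩⟩
  -- If a triple satisfies the clause over `F`, adjoining it to `F` gives another post-fixed point,
  -- so it was already in `F`.
  obtain ⟨X, hX⟩ := (isSet_mem F).or (IsSet.singleton (opair q (opair a b)))
  have hFX : ∀ r π π', TripleMem r π π' F → TripleMem r π π' X := fun r π π' h =>
    tripleMem_iff.2 ((hX _).2 (Or.inl (tripleMem_iff.1 h)))
  refine (hmem q a b hq ha hb).2 ⟨X, fun q' a' b' h' => ?_,
    tripleMem_iff.2 ((hX _).2 (Or.inr rfl))⟩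
  rcases (hX _).1 (tripleMem_iff.1 h') with h' | h'
  · exact (hpost q' a' b' (tripleMem_iff.2 h')).imp hR fun r _ π _ π' _ _ _ => hFX r π π'
  · obtain ⟨e, h'⟩ := opair_inj.1 h'
    obtain ⟨e₁, e₂⟩ := opair_inj.1 h'
    rw [e, e₁, e₂]
    exact h.imp hR fun r _ π _ π' _ _ _ => hFX r π π'

/-- By induction on names the clause has only one solution on the common part of two domains, so
`ForcesEq` does not depend on the chosen `D` and `F`. -/
theorem IsForcesEqOn.unique (hR : IsPartialOrd P R) {D D' F F' : M} (hD : NameClosed P D)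
    (hD' : NameClosed P D') (hF : IsForcesEqOn P R D F) (hF' : IsForcesEqOn P R D' F') (a : M) :
    ∀ q b, q ∊ P → a ∊ D → a ∊ D' → b ∊ D → b ∊ D' → (TripleMem q a b F ↔ TripleMem q a b F') := by
  refine name_induction (fun a => ∀ q b, q ∊ P → a ∊ D → a ∊ D' → b ∊ D → b ∊ D' →
    (TripleMem q a b F ↔ TripleMem q a b F')) (fun a ih q b hq ha ha' hb hb' => ?_) a
  rw [hF q a b hq ha hb, hF' q a b hq ha' hb']
  have key : ∀ r s π s' π', r ∊ P → PairMem s π a → PairMem s' π' b →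
      (TripleMem r π π' F ↔ TripleMem r π π' F') := fun r s π s' π' hr hπ hπ' =>
    ih s π hπ r π' hr (hD.mem ha hπ).2 (hD'.mem ha' hπ).2 (hD.mem hb hπ').2 (hD'.mem hb' hπ').2
  exact ⟨fun h => h.imp hR fun r s π s' π' hr hπ hπ' => (key r s π s' π' hr hπ hπ').1,
    fun h => h.imp hR fun r s π s' π' hr hπ hπ' => (key r s π s' π' hr hπ hπ').2⟩

theorem IsForcesEqOn.iff_forcesEq (hR : IsPartialOrd P R) {D F : M} (hD : NameClosed P D)
    (hF : IsForcesEqOn P R D F) {q a b : M} (hq : q ∊ P) (ha : a ∊ D) (hb : b ∊ D) :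
    TripleMem q a b F ↔ ForcesEq P R q a b := by
  refine ⟨fun h => ⟨D, F, hD, ha, hb, hF, h⟩, ?_⟩
  rintro ⟨D', F', hD', ha', hb', hF', h⟩
  exact (IsForcesEqOn.unique hR hD hD' hF hF' a q b hq ha ha' hb hb').2 h

theorem forcesEq_iff (hR : IsPartialOrd P R) {p σ τ : M} (hp : p ∊ P) (hσ : IsName P σ)
    (hτ : IsName P τ) : ForcesEq P R p σ τ ↔ EqClause R (ForcesEq P R) p σ τ := by
  obtain ⟨D₁, hD₁, hσ⟩ := hσ
  obtain ⟨D₂, hD₂, hτ⟩ := hτ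
  obtain ⟨D, hD, h₁, h₂⟩ := hD₁.union hD₂
  obtain ⟨F, hF⟩ := exists_isForcesEqOn hR hD
  rw [← hF.iff_forcesEq hR hD hp (h₁ σ hσ) (h₂ τ hτ), hF p σ τ hp (h₁ σ hσ) (h₂ τ hτ)]
  have key : ∀ r s π s' π', r ∊ P → PairMem s π σ → PairMem s' π' τ →
      (TripleMem r π π' F ↔ ForcesEq P R r π π') := fun r s π s' π' hr hπ hπ' =>
    hF.iff_forcesEq hR hD hr (hD.mem (h₁ σ hσ) hπ).2 (hD.mem (h₂ τ hτ) hπ').2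
  exact ⟨fun h => h.imp hR fun r s π s' π' hr hπ hπ' => (key r s π s' π' hr hπ hπ').1,
    fun h => h.imp hR fun r s π s' π' hr hπ hπ' => (key r s π s' π' hr hπ hπ').2⟩

section

variable (hR : IsPartialOrd P R)

include hR

theorem ForcesEq.mono {p q σ τ : M} (h : ForcesEq P R p σ τ) (hσ : IsName P σ) (hτ : IsName P τ)
    (hqp : PairMem q p R) : ForcesEq P R q σ τ := by
  rw [forcesEq_iff hR (hR.mem_right hqp) hσ hτ] at h
  exact (forcesEq_iff hR (hR.mem_left hqp) hσ hτ).2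
    ⟨fun s π hπ r hr => h.1 s π hπ r (hR.trans _ _ _ hr hqp),
      fun s π hπ r hr => h.2 s π hπ r (hR.trans _ _ _ hr hqp)⟩

theorem forcesEq_of_dense {p σ τ : M} (hp : p ∊ P) (hσ : IsName P σ) (hτ : IsName P τ)
    (h : ∀ q, PairMem q p R → ∃ r, PairMem r q R ∧ ForcesEq P R r σ τ) :
    ForcesEq P R p σ τ := by
  refine (forcesEq_iff hR hp hσ hτ).2 ⟨fun s π hπ q hqp hqs => ?_, fun s π hπ q hqp hqs => ?_⟩
  · obtain ⟨r, hrq, hr⟩ := h q hqp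
    have hrP := hR.mem_left hrq
    obtain ⟨r', hr', h'⟩ := ((forcesEq_iff hR hrP hσ hτ).1 hr).1 s π hπ r (hR.refl r hrP)
      (hR.trans _ _ _ hrq hqs)
    exact ⟨r', hR.trans _ _ _ hr' hrq, h'⟩
  · obtain ⟨r, hrq, hr⟩ := h q hqp
    have hrP := hR.mem_left hrq
    obtain ⟨r', hr', h'⟩ := ((forcesEq_iff hR hrP hσ hτ).1 hr).2 s π hπ r (hR.refl r hrP)
      (hR.trans _ _ _ hrq hqs)
    exact ⟨r', hR.trans _ _ _ hr' hrq, h'⟩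

theorem ForcesEq.refl {p σ : M} (hp : p ∊ P) (hσ : IsName P σ) : ForcesEq P R p σ σ := by
  refine name_induction (fun σ => ∀ p, p ∊ P → IsName P σ → ForcesEq P R p σ σ)
    (fun σ ih p hp hσ => (forcesEq_iff hR hp hσ hσ).2 ?_) σ p hp hσ
  have key : ∀ s π, PairMem s π σ → ∀ q, PairMem q p R → ForcesEq P R q π π :=
    fun s π hπ q hq => ih s π hπ q (hR.mem_left hq) (hσ.mem hπ).2
  exact ⟨fun s π hπ q hqp hqs => ⟨q, hR.refl q (hR.mem_left hqp), s, π, hπ, hqs, key s π hπ q hqp⟩,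
    fun s π hπ q hqp hqs => ⟨q, hR.refl q (hR.mem_left hqp), s, π, hπ, hqs, key s π hπ q hqp⟩⟩

theorem ForcesEq.symm {p σ τ : M} (h : ForcesEq P R p σ τ) (hp : p ∊ P) (hσ : IsName P σ)
    (hτ : IsName P τ) : ForcesEq P R p τ σ := by
  refine name_induction (fun σ => ∀ p τ, p ∊ P → IsName P σ → IsName P τ → ForcesEq P R p σ τ →
    ForcesEq P R p τ σ) (fun σ ih p τ hp hσ hτ h => ?_) σ p τ hp hσ hτ h
  rw [forcesEq_iff hR hp hσ hτ] at h
  refine (forcesEq_iff hR hp hτ hσ).2 ⟨fun s' π' hπ' q hqp hqs => ?_, fun s π hπ q hqp hqs => ?_⟩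
  · obtain ⟨r, hr, s, π, hπ, hrs, h⟩ := h.2 s' π' hπ' q hqp hqs
    exact ⟨r, hr, s, π, hπ, hrs, ih s π hπ r π' (hR.mem_left hr) (hσ.mem hπ).2 (hτ.mem hπ').2 h⟩
  · obtain ⟨r, hr, s', π', hπ', hrs, h⟩ := h.1 s π hπ q hqp hqs
    exact ⟨r, hr, s', π', hπ', hrs, ih s π hπ r π' (hR.mem_left hr) (hσ.mem hπ).2 (hτ.mem hπ').2 h⟩

theorem ForcesEq.trans {p σ τ ρ : M} (h : ForcesEq P R p σ τ) (h' : ForcesEq P R p τ ρ)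
    (hp : p ∊ P) (hσ : IsName P σ) (hτ : IsName P τ) (hρ : IsName P ρ) : ForcesEq P R p σ ρ := by
  refine name_induction (fun σ => ∀ p τ ρ, p ∊ P → IsName P σ → IsName P τ → IsName P ρ →
    ForcesEq P R p σ τ → ForcesEq P R p τ ρ → ForcesEq P R p σ ρ)
    (fun σ ih p τ ρ hp hσ hτ hρ h h' => ?_) σ p τ ρ hp hσ hτ hρ h h'
  rw [forcesEq_iff hR hp hσ hτ] at h
  rw [forcesEq_iff hR hp hτ hρ] at h'
  refine (forcesEq_iff hR hp hσ hρ).2 ⟨fun s π hπ q hqp hqs => ?_, fun s π hπ q hqp hqs => ?_⟩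
  · obtain ⟨r, hr, s', π', hπ', hrs, hr'⟩ := h.1 s π hπ q hqp hqs
    obtain ⟨t, ht, s'', π'', hπ'', hts, ht'⟩ := h'.1 s' π' hπ' r (hR.trans _ _ _ hr hqp) hrs
    refine ⟨t, hR.trans _ _ _ ht hr, s'', π'', hπ'', hts, ?_⟩
    exact ih s π hπ t π' π'' (hR.mem_left ht) (hσ.mem hπ).2 (hτ.mem hπ').2 (hρ.mem hπ'').2
      (hr'.mono hR (hσ.mem hπ).2 (hτ.mem hπ').2 ht) ht'
  · obtain ⟨r, hr, s', π', hπ', hrs, hr'⟩ := h'.2 s π hπ q hqp hqs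
    obtain ⟨t, ht, s'', π'', hπ'', hts, ht'⟩ := h.2 s' π' hπ' r (hR.trans _ _ _ hr hqp) hrs
    refine ⟨t, hR.trans _ _ _ ht hr, s'', π'', hπ'', hts, ?_⟩
    exact ih s'' π'' hπ'' t π' π (hR.mem_left ht) (hσ.mem hπ'').2 (hτ.mem hπ').2 (hρ.mem hπ).2
      ht' (hr'.mono hR (hτ.mem hπ').2 (hρ.mem hπ).2 ht)

omit hM in
theorem ForcesMem.mono {p q σ τ : M} (h : ForcesMem P R p σ τ) (hqp : PairMem q p R) :
    ForcesMem P R q σ τ :=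
  fun r hr => h r (hR.trans _ _ _ hr hqp)

theorem forcesMem_of_dense {p σ τ : M}
    (h : ∀ q, PairMem q p R → ∃ r, PairMem r q R ∧ ForcesMem P R r σ τ) : ForcesMem P R p σ τ := by
  intro q hqp
  obtain ⟨r, hrq, hr⟩ := h q hqp
  obtain ⟨t, ht, h⟩ := hr r (hR.refl r (hR.mem_left hrq))
  exact ⟨t, hR.trans _ _ _ ht hrq, h⟩

theorem ForcesMem.congr {p σ σ' τ τ' : M} (h : ForcesMem P R p σ τ) (hσσ' : ForcesEq P R p σ σ')
    (hττ' : ForcesEq P R p τ τ') (hp : p ∊ P) (hσ : IsName P σ) (hσ' : IsName P σ')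
    (hτ : IsName P τ) (hτ' : IsName P τ') : ForcesMem P R p σ' τ' := by
  intro q hqp
  obtain ⟨r, hrq, s, π, hπ, hrs, hr⟩ := h q hqp
  have hrp := hR.trans _ _ _ hrq hqp
  have hπN := (hτ.mem hπ).2
  obtain ⟨t, htr, s', π', hπ', hts', ht⟩ := ((forcesEq_iff hR hp hτ hτ').1 hττ').1 s π hπ r hrp hrs
  have htP := hR.mem_left htr
  refine ⟨t, hR.trans _ _ _ htr hrq, s', π', hπ', hts', ?_⟩
  have h1 := (hσσ'.mono hR hσ hσ' (hR.trans _ _ _ htr hrp)).symm hR htP hσ hσ'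
  have h2 := h1.trans hR (hr.mono hR hσ hπN htr) htP hσ' hσ hπN
  exact h2.trans hR ht htP hσ' hπN (hτ'.mem hπ').2

end

omit hM in
theorem isName_snoc {n : ℕ} {σ : Fin n → M} (hσ : ∀ i, IsName P (σ i)) {τ : M}
    (hτ : IsName P τ) (i : Fin (n + 1)) : IsName P ((Fin.snoc σ τ : Fin (n + 1) → M) i) := by
  induction i using Fin.lastCases with
  | last => rwa [Fin.snoc_last]
  | cast i => rw [Fin.snoc_castSucc]; exact hσ i

omit hM in
theorem exists_realize_eq {n : ℕ} (t : LSet.Term (Empty ⊕ Fin n)) :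
    ∃ i : Fin n, ∀ v : Fin n → M, t.realize (Sum.elim Empty.elim v) = v i := by
  rcases t with (e | i) | ⟨f, _⟩
  · exact e.elim
  · exact ⟨i, fun v => rfl⟩
  · exact Empty.elim f

theorem Forces.mono (hR : IsPartialOrd P R) {n : ℕ} (φ : LSet.BoundedFormula Empty n) :
    ∀ {σ : Fin n → M}, (∀ i, IsName P (σ i)) → ∀ {p q}, PairMem q p R → Forces P R φ σ p →
      Forces P R φ σ q := by
  induction φ with
  | falsum => exact fun _ _ _ _ h => h
  | equal s t =>
    intro σ hσ p q hqp h
    obtain ⟨i, hi⟩ := exists_realize_eq (M := M) s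
    obtain ⟨j, hj⟩ := exists_realize_eq (M := M) t
    simp only [Forces, hi, hj] at h ⊢
    exact h.mono hR (hσ i) (hσ j) hqp
  | rel r ts =>
    intro σ hσ p q hqp h
    cases r
    exact ForcesMem.mono hR h hqp
  | imp φ ψ =>
    intro σ hσ p q hqp h r hr
    exact h r (hR.trans _ _ _ hr hqp)
  | all φ ih =>
    intro σ hσ p q hqp h τ hτ
    exact ih (isName_snoc hσ hτ) hqp (h τ hτ)

/-- Density is built into the clauses for membership and implication, is proved for equality in
`forcesEq_of_dense`, and passes through `∀` directly. -/
theorem forces_of_dense (hR : IsPartialOrd P R) {n : ℕ} (φ : LSet.BoundedFormula Empty n) :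
    ∀ {σ : Fin n → M}, (∀ i, IsName P (σ i)) → ∀ {p}, p ∊ P →
      (∀ q, PairMem q p R → ∃ r, PairMem r q R ∧ Forces P R φ σ r) → Forces P R φ σ p := by
  induction φ with
  | falsum =>
    intro σ _ p hp h
    obtain ⟨r, -, h⟩ := h p (hR.refl p hp)
    exact h
  | equal s t =>
    intro σ hσ p hp h
    obtain ⟨i, hi⟩ := exists_realize_eq (M := M) s
    obtain ⟨j, hj⟩ := exists_realize_eq (M := M) t
    simp only [Forces, hi, hj] at h ⊢
    exact forcesEq_of_dense hR hp (hσ i) (hσ j) h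
  | rel r ts =>
    intro σ hσ p hp h
    cases r
    exact forcesMem_of_dense hR h
  | imp φ ψ =>
    intro σ hσ p hp h q hqp hq
    obtain ⟨r, hrq, hr⟩ := h q hqp
    obtain ⟨t, ht, h⟩ := hr r (hR.refl r (hR.mem_left hrq)) (Forces.mono hR φ hσ hrq hq)
    exact ⟨t, hR.trans _ _ _ ht hrq, h⟩
  | all φ ih =>
    intro σ hσ p hp h τ hτ
    refine ih (isName_snoc hσ hτ) hp fun q hq => ?_
    obtain ⟨r, hr, h⟩ := h q hq
    exact ⟨r, hr, h τ hτ⟩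

theorem Forces.congr (hR : IsPartialOrd P R) {n : ℕ} (φ : LSet.BoundedFormula Empty n) :
    ∀ {σ σ' : Fin n → M}, (∀ i, IsName P (σ i)) → (∀ i, IsName P (σ' i)) → ∀ {p}, p ∊ P →
      (∀ i, ForcesEq P R p (σ i) (σ' i)) → Forces P R φ σ p → Forces P R φ σ' p := by
  induction φ with
  | falsum => exact fun _ _ _ _ _ h => h
  | equal s t =>
    intro σ σ' hσ hσ' p hp hσσ' h
    obtain ⟨i, hi⟩ := exists_realize_eq (M := M) s
    obtain ⟨j, hj⟩ := exists_realize_eq (M := M) t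
    simp only [Forces, hi, hj] at h ⊢
    exact (((hσσ' i).symm hR hp (hσ i) (hσ' i)).trans hR h hp (hσ' i) (hσ i) (hσ j)).trans hR
      (hσσ' j) hp (hσ' i) (hσ j) (hσ' j)
  | rel r ts =>
    intro σ σ' hσ hσ' p hp hσσ' h
    cases r
    obtain ⟨i, hi⟩ := exists_realize_eq (M := M) (ts 0)
    obtain ⟨j, hj⟩ := exists_realize_eq (M := M) (ts 1)
    simp only [Forces, ForcesRel, hi, hj] at h ⊢
    exact h.congr hR (hσσ' i) (hσσ' j) hp (hσ i) (hσ' i) (hσ j) (hσ' j)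
  | imp φ ψ ih₁ ih₂ =>
    intro σ σ' hσ hσ' p hp hσσ' h q hqp hq
    have hqP := hR.mem_left hqp
    have he : ∀ i, ForcesEq P R q (σ i) (σ' i) := fun i => (hσσ' i).mono hR (hσ i) (hσ' i) hqp
    obtain ⟨r, hr, h⟩ := h q hqp
      (ih₁ hσ' hσ hqP (fun i => (he i).symm hR hqP (hσ i) (hσ' i)) hq)
    exact ⟨r, hr, ih₂ hσ hσ' (hR.mem_left hr) (fun i => (he i).mono hR (hσ i) (hσ' i) hr) h⟩
  | all φ ih =>
    intro σ σ' hσ hσ' p hp hσσ' h τ hτ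
    refine ih (isName_snoc hσ hτ) (isName_snoc hσ' hτ) hp (fun i => ?_) (h τ hτ)
    induction i using Fin.lastCases with
    | last => simpa only [Fin.snoc_last] using ForcesEq.refl hR hp hτ
    | cast i => simpa only [Fin.snoc_castSucc] using hσσ' i

omit hM in
/-- The forcing relation for a fixed formula is definable. -/
theorem defP_forces (P R : M) {n : ℕ} (φ : LSet.BoundedFormula Empty n) :
    ∀ (g : Fin n → (ℕ → M) → M) (f : (ℕ → M) → M), (∀ i, DefF (g i)) → DefF f →
      DefP fun v => Forces P R φ (fun i => g i v) (f v) := by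
  induction φ with
  | falsum => exact fun g f _ _ => DefP.const False
  | equal s t =>
    intro g f hg hf
    obtain ⟨i, hi⟩ := exists_realize_eq (M := M) s
    obtain ⟨j, hj⟩ := exists_realize_eq (M := M) t
    have := hg i
    have := hg j
    simp only [Forces, hi, hj]
    infer_instance
  | rel r ts =>
    intro g f hg hf
    cases r
    obtain ⟨i, hi⟩ := exists_realize_eq (M := M) (ts 0)
    obtain ⟨j, hj⟩ := exists_realize_eq (M := M) (ts 1)
    have := hg i
    have := hg j
    simp only [Forces, ForcesRel, hi, hj]
    infer_instance
  | imp φ ψ ih₁ ih₂ =>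
    intro g f hg hf
    have h0 := hf.reindex fun n => n + 1
    have h1 := ih₁ (fun i v => g i fun n => v (n + 1)) (fun v => v 0)
      (fun i => (hg i).reindex _) inferInstance
    have h2 := ih₂ (fun i v => g i fun n => v (n + 1 + 1)) (fun v => v 0)
      (fun i => (hg i).reindex fun n => n + 1 + 1) inferInstance
    exact @DefP.all _ _ _ (@DefP.imp _ _ _ _ inferInstance (@DefP.imp _ _ _ _ h1
      (@DefP.ex _ _ _ (@DefP.and _ _ _ _ inferInstance h2))))
  | all φ ih =>
    intro g f hg hf
    have h1 := ih (Fin.snoc (fun i v => g i fun n => v (n + 1)) fun v => v 0)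
      (fun v => f fun n => v (n + 1)) (fun i => ?_) (hf.reindex _)
    · refine @DefP.all _ _ _ (@DefP.imp _ _ _ _ inferInstance (h1.congr fun v => ?_))
      refine iff_of_eq (congrArg (fun σ => Forces P R φ σ _) (funext fun i => ?_))
      induction i using Fin.lastCases with
      | last => simp only [Fin.snoc_last]
      | cast i => simp only [Fin.snoc_castSucc]
    · induction i using Fin.lastCases with
      | last => rw [Fin.snoc_last]; infer_instance
      | cast i => rw [Fin.snoc_castSucc]; exact (hg i).reindex _

end Forcing

/-! ### Mixing names, and the two implications -/

section Equivalence

variable {M : Type u} [LSet.Structure M] [hM : Fact (IsModelZF M)] {P R : M}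

/-- The mixing lemma: along a linear relation `lt` on `A`, the names `t r` for `r ∈ A` can be glued
to a name which is equal to `t r` below `r` and away from all smaller conditions. -/
theorem exists_mixture (hR : IsPartialOrd P R) {A : M} {t : M → M} (ht : DefF fun v => t (v 0))
    (htN : ∀ r, r ∊ A → IsName P (t r)) {lt : M → M → Prop} (hlt : DefP fun v => lt (v 0) (v 1))
    (hlin : ∀ x y, x ∊ A → y ∊ A → x ≠ y → lt x y ∨ lt y x) :
    ∃ τ, IsName P τ ∧ ∀ r, r ∊ A → ∀ q, PairMem q r R →
      (∀ r', r' ∊ A → lt r' r → ¬ ∃ u, PairMem u q R ∧ PairMem u r' R) →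
        ForcesEq P R q τ (t r) := by
  have ht' : ∀ {f : (ℕ → M) → M} [DefF f], DefF fun v => t (f v) :=
    fun {f} [hf : DefF f] => DefF.subst₁ ht hf
  have hlt' : ∀ {f g : (ℕ → M) → M} [DefF f] [DefF g], DefP fun v => lt (f v) (g v) :=
    fun {f g} [hf : DefF f] [hg : DefF g] => DefP.subst₂ hlt hf hg
  -- A pair `⟨s, π⟩` enters `τ` when `s` selects `r` as its first compatible index and lies below a
  -- condition attached to `π` in `t r`.
  let B : M → M → Prop := fun s π => ∃ r, r ∊ A ∧ PairMem s r R ∧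
    (∃ s', PairMem s' π (t r) ∧ PairMem s s' R) ∧
    ∀ r', r' ∊ A → lt r' r → ¬ ∃ u, PairMem u s R ∧ PairMem u r' R
  have hB : DefP fun v : ℕ → M => B (v 0) (v 1) := by unfold B; infer_instance
  have hB' : ∀ {f g : (ℕ → M) → M} [DefF f] [DefF g], DefP fun v => B (f v) (g v) :=
    fun {f g} [hf : DefF f] [hg : DefF g] => DefP.subst₂ hB hf hg
  have hD : DefP fun v : ℕ → M => ∃ s π, v 0 = opair s π ∧ s ∊ P ∧ B s π := by
    clear_value B
    infer_instance
  -- Three unions reach the names `π` occurring in pairs of some `t r`, so `τ` is cut out of `P ×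
  -- N`.
  obtain ⟨N, hN⟩ := ((isSet_mem A).image t).sUnion.sUnion.sUnion
  obtain ⟨τ, hτ⟩ := (IsSet.prod P N).subset
    (D := fun z => ∃ s π, z = opair s π ∧ s ∊ P ∧ B s π) (by
      rintro z ⟨s, π, rfl, hs, r, hr, -, ⟨s', hπ, -⟩, -⟩
      refine ⟨s, hs, π, (hN π).2 ?_, rfl⟩
      obtain ⟨u, hu, hπu⟩ := mem_opair_right s' π
      exact ⟨u, ⟨_, ⟨_, ⟨r, hr, rfl⟩, pairMem_iff.1 hπ⟩, hu⟩, hπu⟩)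
  have hmem : ∀ s π, PairMem s π τ ↔ s ∊ P ∧ B s π := by
    intro s π
    rw [pairMem_iff, hτ]
    constructor
    · rintro ⟨s', π', h, h'⟩
      obtain ⟨rfl, rfl⟩ := opair_inj.1 h
      exact h'
    · exact fun h => ⟨s, π, rfl, h⟩
  have hτN : IsName P τ := by
    refine isName_iff.2 fun z hz => ?_
    obtain ⟨s, π, rfl, hs, r, hr, -, ⟨s', hπ, -⟩, -⟩ := (hτ z).1 hz
    exact ⟨s, π, rfl, hs, ((htN r hr).mem hπ).2⟩
  refine ⟨τ, hτN, fun r hr q hqr hq => ?_⟩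
  refine (forcesEq_iff hR (hR.mem_left hqr) hτN (htN r hr)).2
    ⟨fun s π hπ q' hq' hs => ?_, fun s π hπ q' hq' hs => ?_⟩
  · obtain ⟨-, r', hr', hsr', ⟨s', hπ, hss'⟩, hmin⟩ := (hmem s π).1 hπ
    have hqP := hR.mem_left hq'
    -- `q'` lies below both `r` and `r'`; were they distinct, the earlier one would be compatible
    -- with a condition required to be incompatible with it.
    have hrr' : r' = r := by
      by_contra hne
      rcases hlin r' r hr' hr hne with h | h
      · exact hq r' hr' h ⟨q', hq', hR.trans _ _ _ hs hsr'⟩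
      · exact hmin r hr h ⟨q', hs, hR.trans _ _ _ hq' hqr⟩
    subst hrr'
    exact ⟨q', hR.refl q' hqP, s', π, hπ, hR.trans _ _ _ hs hss',
      ForcesEq.refl hR hqP ((htN r' hr').mem hπ).2⟩
  · have hqP := hR.mem_left hq'
    refine ⟨q', hR.refl q' hqP, q', π, (hmem q' π).2 ⟨hqP, r, hr, hR.trans _ _ _ hq' hqr,
      ⟨s, hπ, hs⟩, ?_⟩, hR.refl q' hqP, ForcesEq.refl hR hqP ((htN r hr).mem hπ).2⟩
    rintro r' hr' hlt ⟨u, hu, hur⟩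
    exact hq r' hr' hlt ⟨u, hR.trans _ _ _ hu hq', hur⟩

omit hM in
theorem defP_forces_snoc (P R : M) {n : ℕ} (θ : LSet.BoundedFormula Empty (n + 1)) (σ : Fin n → M) :
    DefP fun v => Forces P R θ (Fin.snoc σ (v 1)) (v 0) := by
  refine (defP_forces P R θ (Fin.snoc (fun i _ => σ i) fun v => v 1) (fun v => v 0)
    (fun i => ?_) inferInstance).congr fun v => ?_
  · induction i using Fin.lastCases with
    | last => rw [Fin.snoc_last]; infer_instance
    | cast i => rw [Fin.snoc_castSucc]; infer_instance
  · refine iff_of_eq (congrArg (fun σ => Forces P R θ σ _) (funext fun i => ?_))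
    induction i using Fin.lastCases with
    | last => simp only [Fin.snoc_last]
    | cast i => simp only [Fin.snoc_castSucc]

theorem AxiomOfChoice.maximumPrinciple (hAC : AxiomOfChoice M) : MaximumPrinciple M := by
  intro P R hR n θ σ hσ p hp
  rw [forces_ex]
  constructor
  swap
  · rintro ⟨τ, hτ, h⟩ q hq
    exact ⟨q, hR.refl q (hR.mem_left hq), τ, hτ, Forces.mono hR θ (isName_snoc hσ hτ) hq h⟩
  intro hex
  have hθ := defP_forces_snoc P R θ σ
  have hθ' : ∀ {f g : (ℕ → M) → M} [DefF f] [DefF g],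
      DefP fun v => Forces P R θ (Fin.snoc σ (f v)) (g v) := fun {f g} [hf : DefF f] [hg : DefF g] =>
    DefP.subst₂ (C := fun x y => Forces P R θ (Fin.snoc σ y) x) hθ hg hf
  obtain ⟨A, hA⟩ := (isSet_mem P).inter fun r => ∃ τ, IsName P τ ∧ Forces P R θ (Fin.snoc σ τ) r
  -- The witnessing names for `r` may form a proper class, so choice is applied to Scott's sets `S
  -- r`.
  obtain ⟨S, hS, hSC, hSne⟩ := exists_scott
    fun r τ => IsName P τ ∧ Forces P R θ (Fin.snoc σ τ) r
  obtain ⟨a, ha⟩ := (isSet_mem A).image S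
  obtain ⟨c, hc, hc'⟩ := exists_choice hAC a
  have ht : ∀ r, r ∊ A → IsName P (c (S r)) ∧ Forces P R θ (Fin.snoc σ (c (S r))) r :=
    fun r hr => hSC r _ (hc' _ ((ha _).2 ⟨r, hr, rfl⟩) (hSne r ((hA r).1 hr).2))
  obtain ⟨lt, hlt, hlin, hwf⟩ := exists_wellOrder hAC A
  obtain ⟨τ, hτ, hmix⟩ := exists_mixture hR (t := fun r => c (S r)) (DefF.subst₁ hc hS)
    (fun r hr => (ht r hr).1) hlt hlin
  refine ⟨τ, hτ, forces_of_dense hR θ (isName_snoc hσ hτ) hp fun q hqp => ?_⟩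
  -- The indices compatible with `q`. For the least of them, `r`, a common extension `u` of `q` and
  -- `r` is incompatible with all earlier indices, as anything compatible with `u` is compatible
  -- with `q`.
  obtain ⟨B, hB⟩ := (isSet_mem A).inter fun r => ∃ u, PairMem u q R ∧ PairMem u r R
  obtain ⟨r₀, hr₀q, hr₀⟩ := hex q hqp
  have hr₀P := hR.mem_left hr₀q
  obtain ⟨r, hr, hmin⟩ := hwf B (fun x hx => ((hB x).1 hx).1)
    ⟨r₀, (hB r₀).2 ⟨(hA r₀).2 ⟨hr₀P, hr₀⟩, r₀, hr₀q, hR.refl r₀ hr₀P⟩⟩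
  obtain ⟨hrA, u, huq, hur⟩ := (hB r).1 hr
  have huP := hR.mem_left huq
  refine ⟨u, huq, ?_⟩
  have heq := hmix r hrA u hur fun r' hr' hlt ⟨w, hw, hwr⟩ =>
    hmin r' ((hB r').2 ⟨hr', w, hR.trans _ _ _ hw huq, hwr⟩) hlt
  refine Forces.congr hR θ (isName_snoc hσ (ht r hrA).1) (isName_snoc hσ hτ) huP (fun i => ?_)
    (Forces.mono hR θ (isName_snoc hσ (ht r hrA).1) hur (ht r hrA).2)
  induction i using Fin.lastCases with
  | last =>
    simp only [Fin.snoc_last]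
    exact heq.symm hR huP hτ (ht r hrA).1
  | cast i =>
    simp only [Fin.snoc_castSucc]
    exact ForcesEq.refl hR huP (hσ i)

/-- For a condition `e`, the canonical names `y̌ = {⟨e, ž⟩ | z ∈ y}`. -/
theorem exists_check (e : M) : ∃ F : M → M, (DefF fun v => F (v 0)) ∧
    ∀ y x, x ∊ F y ↔ ∃ z, z ∊ y ∧ x = opair e (F z) := by
  let H : M → M := fun s => build fun x => ∃ d, d ∊ s ∧ x = opair e d
  have : DefF fun v : ℕ → M => H (v 0) := by unfold H; infer_instance
  obtain ⟨F, hF, h⟩ := exists_rec H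
  refine ⟨F, hF, fun y x => ?_⟩
  rw [h y, mem_build ((isSet_mem _).image fun d => opair e d)]
  simp only [mem_build ((isSet_mem y).image F)]
  constructor
  · rintro ⟨_, ⟨z, hz, rfl⟩, rfl⟩
    exact ⟨z, hz, rfl⟩
  · rintro ⟨z, hz, rfl⟩
    exact ⟨_, ⟨z, hz, rfl⟩, rfl⟩

/-- The flat partial order on `a ∪ {a}` with top element `a`. -/
theorem exists_flatOrder (a : M) : ∃ P R : M, IsPartialOrd P R ∧ (∀ x, x ∊ P ↔ x ∊ a ∨ x = a) ∧
    ∀ q p, PairMem q p R ↔ q ∊ P ∧ (p = q ∨ p = a) := by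
  obtain ⟨P, hP⟩ := (isSet_mem a).or (IsSet.singleton a)
  have ha : a ∊ P := (hP a).2 (Or.inr rfl)
  obtain ⟨R, hR⟩ := (IsSet.prod P P).inter fun z => ∃ q p, z = opair q p ∧ (p = q ∨ p = a)
  have hle : ∀ q p, PairMem q p R ↔ q ∊ P ∧ (p = q ∨ p = a) := by
    intro q p
    rw [pairMem_iff, hR]
    constructor
    · rintro ⟨⟨q', hq, p', hp, h⟩, q'', p'', h', h''⟩
      obtain ⟨rfl, rfl⟩ := opair_inj.1 h
      obtain ⟨rfl, rfl⟩ := opair_inj.1 h'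
      exact ⟨hq, h''⟩
    · rintro ⟨hq, h⟩
      exact ⟨⟨q, hq, p, h.elim (fun h => h ▸ hq) fun h => h ▸ ha, rfl⟩, q, p, rfl, h⟩
  refine ⟨P, R, ⟨fun z hz => ?_, fun p hp => (hle p p).2 ⟨hp, Or.inl rfl⟩, fun p q h h' => ?_,
    fun p q r h h' => ?_⟩, hP, hle⟩
  · obtain ⟨⟨q, hq, p, hp, rfl⟩, -⟩ := (hR z).1 hz
    exact ⟨q, p, isOPair_opair q p, hq, hp⟩
  · rcases ((hle p q).1 h).2 with rfl | rfl
    · rfl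
    · exact ((hle _ p).1 h').2.elim id id
  · refine (hle p r).2 ⟨((hle p q).1 h).1, ?_⟩
    rcases ((hle q r).1 h').2 with rfl | rfl
    · exact ((hle p _).1 h).2
    · exact Or.inr rfl

theorem MaximumPrinciple.axiomOfChoice (hMP : MaximumPrinciple M) : AxiomOfChoice M := by
  intro a hne
  obtain ⟨P, R, hR, hP, hle⟩ := exists_flatOrder a
  obtain ⟨F, hF, hmem⟩ := exists_check a
  have hF' : ∀ {f : (ℕ → M) → M} [DefF f], DefF fun v => F (f v) :=
    fun {f} [hf : DefF f] => DefF.subst₁ hF hf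
  have haP : a ∊ P := (hP a).2 (Or.inr rfl)
  have hFN : ∀ y, IsName P (F y) := by
    refine mem_induction (fun y => IsName P (F y)) fun y ih => isName_iff.2 fun x hx => ?_
    obtain ⟨z, hz, rfl⟩ := (hmem y x).1 hx
    exact ⟨a, F z, rfl, haP, ih z hz⟩
  -- Elements of `a` are minimal conditions, because `a ∉ a` separates them from the top.
  have hatom : ∀ x, x ∊ a → ∀ r, PairMem r x R → r = x := by
    intro x hx r hr
    rcases ((hle r x).1 hr).2 with h | rfl
    · exact h.symm
    · exact absurd hx (mem_irrefl x)
  have htop : ∀ x, x ∊ P → PairMem x a R := fun x hx => (hle x a).2 ⟨hx, Or.inr rfl⟩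
  -- At an atom the only extension is the atom itself, so forced equality of canonical names
  -- reduces, by ∈-induction, to actual equality.
  have hinj : ∀ x, x ∊ a → ∀ y y', ForcesEq P R x (F y) (F y') → y = y' := by
    intro x hx
    have hxP := (hP x).2 (Or.inl hx)
    have hxx := hR.refl x hxP
    refine mem_induction (fun y => ∀ y', ForcesEq P R x (F y) (F y') → y = y')
      fun y ih y' h => ext fun z => ?_
    rw [forcesEq_iff hR hxP (hFN y) (hFN y')] at h
    have hmem' : ∀ z y, z ∊ y → PairMem a (F z) (F y) :=
      fun z y hz => pairMem_iff.2 ((hmem y _).2 ⟨z, hz, rfl⟩)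
    constructor
    · intro hz
      obtain ⟨r, hr, s, π, hπ, -, heq⟩ := h.1 a (F z) (hmem' z y hz) x hxx (htop x hxP)
      obtain ⟨z', hz', h'⟩ := (hmem y' _).1 (pairMem_iff.1 hπ)
      obtain ⟨rfl, rfl⟩ := opair_inj.1 h'
      rw [hatom x hx r hr] at heq
      rwa [ih z hz z' heq]
    · intro hz
      obtain ⟨r, hr, s, π, hπ, -, heq⟩ := h.2 a (F z) (hmem' z y' hz) x hxx (htop x hxP)
      obtain ⟨z', hz', h'⟩ := (hmem y _).1 (pairMem_iff.1 hπ)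
      obtain ⟨rfl, rfl⟩ := opair_inj.1 h'
      rw [hatom x hx r hr] at heq
      rwa [← ih z' hz' z heq]
  -- The name `σ` of the element of `a` whose condition lies in the generic filter.
  obtain ⟨σ, hσ⟩ := (isSet_mem a).biUnion (fun x z => ∃ y, y ∊ x ∧ z = opair x (F y))
    fun x _ => (isSet_mem x).image fun y => opair x (F y)
  have hσN : IsName P σ := by
    refine isName_iff.2 fun z hz => ?_
    obtain ⟨x, hx, y, -, rfl⟩ := (hσ z).1 hz
    exact ⟨x, F y, rfl, (hP x).2 (Or.inl hx), hFN y⟩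
  by_cases hempty : ∃ x, x ∊ a
  swap
  -- Without atoms the top does not force `σ` to be nonempty, so this case is separate; the empty
  -- function works.
  · obtain ⟨f, hf⟩ := isSet_false (M := M)
    exact ⟨f, fun z hz => ((hf z).1 hz).elim, fun x hx => (hempty ⟨x, hx⟩).elim⟩
  let r : LSet.Relations 2 := SetRel.mem
  let θ : LSet.BoundedFormula Empty 2 :=
    -- Variable 1 is the quantified one and variable 0 is the parameter, so this is `x ∈ σ`.
    Relations.boundedFormula r ![Term.var (Sum.inr 1), Term.var (Sum.inr 0)]
  have hθ : ∀ p τ, Forces P R θ (Fin.snoc (fun _ : Fin 1 => σ) τ) p ↔ ForcesMem P R p τ σ :=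
    fun p τ => Iff.rfl
  obtain ⟨τ, hτN, hτ⟩ := (hMP P R hR 1 θ (fun _ => σ) (fun _ => hσN) a haP).1 (by
    rw [forces_ex]
    intro q hq
    obtain ⟨x, hx, hxq⟩ : ∃ x, x ∊ a ∧ PairMem x q R := by
      rcases (hP q).1 (hR.mem_left hq) with h | rfl
      · exact ⟨q, h, hR.refl q (hR.mem_left hq)⟩
      · obtain ⟨x, hx⟩ := hempty
        exact ⟨x, hx, htop x ((hP x).2 (Or.inl hx))⟩
    obtain ⟨y, hy⟩ := hne x hx
    refine ⟨x, hxq, F y, hFN y, (hθ _ _).2 fun s hs => ?_⟩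
    rw [hatom x hx s hs]
    have hxP := (hP x).2 (Or.inl hx)
    exact ⟨x, hR.refl x hxP, x, F y, pairMem_iff.2 ((hσ _).2 ⟨x, hx, y, hy, rfl⟩),
      hR.refl x hxP, ForcesEq.refl hR hxP (hFN y)⟩)
  rw [hθ] at hτ
  obtain ⟨f, hf⟩ := (isSet_mem a).biUnion
    (fun x z => ∃ y, (y ∊ x ∧ ForcesEq P R x τ (F y)) ∧ z = opair x y)
    fun x _ => (IsSet.sep x fun y => ForcesEq P R x τ (F y)).image fun y => opair x y
  refine ⟨f, fun z hz => ?_, fun x hx => ?_⟩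
  · obtain ⟨x, hx, y, ⟨hy, -⟩, rfl⟩ := (hf z).1 hz
    exact ⟨x, y, isOPair_opair x y, hx, hy⟩
  · have hxP := (hP x).2 (Or.inl hx)
    have hfx : ∀ y, PairMem x y f ↔ y ∊ x ∧ ForcesEq P R x τ (F y) := by
      intro y
      rw [pairMem_iff, hf]
      constructor
      · rintro ⟨x', -, y', h, h'⟩
        obtain ⟨rfl, rfl⟩ := opair_inj.1 h'
        exact h
      · exact fun h => ⟨x, hx, y, h, rfl⟩
    simp only [hfx]
    -- Since `x` is an atom, `q = x`. The condition `s` of the pair in `σ` is also an atom above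
    -- `x`, so `s = x` and `π` is the canonical name of an element of `x`.
    obtain ⟨q, hq, s, π, hπ, hqs, heq⟩ := hτ x (htop x hxP)
    rw [hatom x hx q hq] at hqs heq
    obtain ⟨x', hx', y, hy, h⟩ := (hσ _).1 (pairMem_iff.1 hπ)
    obtain ⟨rfl, rfl⟩ := opair_inj.1 h
    rw [← hatom s hx' x hqs] at hy
    refine ⟨y, ⟨hy, heq⟩, fun y' ⟨_, h'⟩ => ?_⟩
    exact hinj x hx y' y ((h'.symm hR hxP hτN (hFN y')).trans hR heq hxP (hFN y') hτN (hFN y))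

end Equivalence

end MaxPrinciple

theorem theorem2 {M : Type*} [MaxPrinciple.LSet.Structure M]
    (hM : MaxPrinciple.IsModelZF M) :
    MaxPrinciple.AxiomOfChoice M ↔ MaxPrinciple.MaximumPrinciple M :=
  have : Fact (MaxPrinciple.IsModelZF M) := ⟨hM⟩
  ⟨MaxPrinciple.AxiomOfChoice.maximumPrinciple, MaxPrinciple.MaximumPrinciple.axiomOfChoice⟩
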